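/- Let $n\in\mathbb N$ and $p\in\mathbb R$ with $2<p<n$, and let $a_\epsilon\in C(\mathbb R^n,\mathbb R)$, $\epsilon\in[0,1]$, satisfy $a_\epsilon(x)\ge 1$ for all $x\in\mathbb R^n$ and $\epsilon\in[0,1]$, $\|a_\epsilon-a_0\|_{L^\infty(\mathbb R^n)}\to 0$ as $\epsilon\to 0$, and $$\int_{\mathbb R^n} a_0(x)^{-\frac{2}{p-2}}\,dx<\infty. \qquad (*)$$ For $\epsilon\in[0,1]$ let $E_\epsilon=\{u\in W^{1,p}(\mathbb R^n):\int_{\mathbb R^n}a_\epsilon|u|^p\,dx<\infty\}$ (real-valued functions), with the norm $$\|u\|_{E_\epsilon}=\Big[\int_{\mathbb R^n}\big(|\nabla u|^p+a_\epsilon|u|^p\big)\,dx\Big]^{1/p},$$ and let $p^*=\frac{pn}{n-p}$. Then there is $\epsilon_0\in(0,1]$ such that, for every $\epsilon\in[0,\epsilon_0]$, $a_\epsilon$ also satisfies $(*)$, $E_\epsilon$ is a reflexive Banach space, and: (i) for every $r\in[2,p^*]$, $E_\epsilon$ is contained in $L^r(\mathbb R^n)$, the inclusion is continuous and has dense image,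 and $\|u\|_{L^r(\mathbb R^n)}\le C\|u\|_{E_\epsilon}$ for all $u\in E_\epsilon$, where the constant $C$ may depend on $r$ but not on $\epsilon\in[0,\epsilon_0]$; (ii) for every $r\in[2,p^*)$, the inclusion $E_\epsilon\to L^r(\mathbb R^n)$ is compact. -/

import Mathlib

open MeasureTheory Filter Set
open scoped Topology ENNReal ContDiff

/-- `g` is the weak (distributional) gradient of `u` on `ℝⁿ`: both are locally integrable and
`∫ u ∂ᵢφ = - ∫ gᵢ φ` for every test function `φ ∈ C_c^∞(ℝⁿ)` and every coordinate `i`. -/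
structure IsWeakGradient {n : ℕ} (u : EuclideanSpace ℝ (Fin n) → ℝ)
    (g : EuclideanSpace ℝ (Fin n) → EuclideanSpace ℝ (Fin n)) : Prop where
  locallyIntegrable : LocallyIntegrable u volume
  locallyIntegrable_grad : LocallyIntegrable g volume
  integral_eq : ∀ φ : EuclideanSpace ℝ (Fin n) → ℝ, ContDiff ℝ ∞ φ → HasCompactSupport φ →
    ∀ i : Fin n, ∫ x, u x * fderiv ℝ φ x (EuclideanSpace.single i 1) = -∫ x, g x i * φ x

namespace IsWeakGradient

variable {n : ℕ} {u v : EuclideanSpace ℝ (Fin n) → ℝ}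
  {g h : EuclideanSpace ℝ (Fin n) → EuclideanSpace ℝ (Fin n)}

theorem integrable_left (hu : LocallyIntegrable u volume)
    {φ : EuclideanSpace ℝ (Fin n) → ℝ} (hφ : ContDiff ℝ ∞ φ) (hc : HasCompactSupport φ)
    (i : Fin n) :
    Integrable (fun x => u x * fderiv ℝ φ x (EuclideanSpace.single i 1)) := by
  have h1 : Continuous fun x => fderiv ℝ φ x (EuclideanSpace.single i 1) :=
    (hφ.continuous_fderiv (by simp)).clm_apply continuous_const
  have h2 : HasCompactSupport fun x => fderiv ℝ φ x (EuclideanSpace.single i 1) :=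
    hc.fderiv_apply ℝ _
  simpa [smul_eq_mul, mul_comm] using hu.integrable_smul_left_of_hasCompactSupport h1 h2

theorem locallyIntegrable_apply (hg : LocallyIntegrable g volume) (i : Fin n) :
    LocallyIntegrable (fun x => g x i) volume := by
  intro x
  obtain ⟨s, hs, hi⟩ := hg x
  exact ⟨s, hs, (EuclideanSpace.proj (𝕜 := ℝ) i).integrable_comp hi⟩

theorem integrable_right (hg : LocallyIntegrable g volume)
    {φ : EuclideanSpace ℝ (Fin n) → ℝ} (hφ : ContDiff ℝ ∞ φ) (hc : HasCompactSupport φ)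
    (i : Fin n) : Integrable (fun x => g x i * φ x) := by
  simpa [smul_eq_mul, mul_comm] using
    (locallyIntegrable_apply hg i).integrable_smul_left_of_hasCompactSupport hφ.continuous hc

theorem add (hu : IsWeakGradient u g) (hv : IsWeakGradient v h) :
    IsWeakGradient (u + v) (g + h) where
  locallyIntegrable := hu.1.add hv.1
  locallyIntegrable_grad := hu.2.add hv.2
  integral_eq φ hφ hc i := by
    simp only [Pi.add_apply, PiLp.add_apply, add_mul]
    rw [integral_add (integrable_left hu.1 hφ hc i) (integrable_left hv.1 hφ hc i),
      integral_add (integrable_right hu.2 hφ hc i) (integrable_right hv.2 hφ hc i),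
      hu.3 φ hφ hc i, hv.3 φ hφ hc i]
    ring

theorem smul (c : ℝ) (hu : IsWeakGradient u g) : IsWeakGradient (c • u) (c • g) where
  locallyIntegrable := hu.1.smul c
  locallyIntegrable_grad := hu.2.smul c
  integral_eq φ hφ hc i := by
    simp only [Pi.smul_apply, PiLp.smul_apply, smul_eq_mul, mul_assoc]
    rw [integral_const_mul, integral_const_mul, hu.3 φ hφ hc i]
    ring

theorem zero : IsWeakGradient (0 : EuclideanSpace ℝ (Fin n) → ℝ) 0 where
  locallyIntegrable := locallyIntegrable_zero
  locallyIntegrable_grad := locallyIntegrable_zero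
  integral_eq φ _ _ i := by simp

theorem congr (hu : IsWeakGradient u g) (huv : u =ᵐ[volume] v) : IsWeakGradient v g where
  locallyIntegrable := hu.1.congr huv
  locallyIntegrable_grad := hu.2
  integral_eq φ hφ hc i := by
    rw [← hu.3 φ hφ hc i]
    refine integral_congr_ae ?_
    filter_upwards [huv] with x hx
    rw [hx]

theorem ae_unique (hg : IsWeakGradient u g) (hh : IsWeakGradient u h) : g =ᵐ[volume] h := by
  have key : ∀ i : Fin n, ∀ᵐ x ∂(volume : Measure (EuclideanSpace ℝ (Fin n))),
      g x i = h x i := fun i => by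
    refine ae_eq_of_integral_contDiff_smul_eq (locallyIntegrable_apply hg.2 i)
      (locallyIntegrable_apply hh.2 i) fun φ hφ hc => ?_
    have := (hg.3 φ hφ hc i).symm.trans (hh.3 φ hφ hc i)
    simpa [smul_eq_mul, mul_comm] using this
  filter_upwards [ae_all_iff.2 key] with x hx
  ext i
  exact hx i

end IsWeakGradient

/-- The Sobolev space `W^{1,p}(ℝⁿ)` of real functions, as a subspace of `L^p(ℝⁿ)`: the functions
in `L^p` with a weak gradient in `L^p`. -/
def sobolevW1p (n : ℕ) (p : ℝ) :
    Submodule ℝ (Lp ℝ (ENNReal.ofReal p) (volume : Measure (EuclideanSpace ℝ (Fin n)))) where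
  carrier := {u | ∃ g : EuclideanSpace ℝ (Fin n) → EuclideanSpace ℝ (Fin n),
    MemLp g (ENNReal.ofReal p) volume ∧ IsWeakGradient u g}
  add_mem' := by
    rintro u v ⟨g, hg, hug⟩ ⟨h, hh, hvh⟩
    exact ⟨g + h, hg.add hh, (hug.add hvh).congr (Lp.coeFn_add u v).symm⟩
  zero_mem' := ⟨0, MemLp.zero, IsWeakGradient.zero.congr (Lp.coeFn_zero _ _ _).symm⟩
  smul_mem' := by
    rintro c u ⟨g, hg, hug⟩
    exact ⟨c • g, hg.const_smul c, (hug.smul c).congr (Lp.coeFn_smul c u).symm⟩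

/-- The weak gradient `∇u` of `u ∈ W^{1,p}(ℝⁿ)` (unique up to null sets). -/
noncomputable def weakGrad {n : ℕ} {p : ℝ} (u : sobolevW1p n p) :
    EuclideanSpace ℝ (Fin n) → EuclideanSpace ℝ (Fin n) :=
  u.2.choose

theorem memLp_weakGrad {n : ℕ} {p : ℝ} (u : sobolevW1p n p) :
    MemLp (weakGrad u) (ENNReal.ofReal p) volume := u.2.choose_spec.1

theorem isWeakGradient_weakGrad {n : ℕ} {p : ℝ} (u : sobolevW1p n p) :
    IsWeakGradient u.1 (weakGrad u) := u.2.choose_spec.2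

theorem integrable_weight_iff {n : ℕ} {p : ℝ} (hp : 1 ≤ p)
    {a : EuclideanSpace ℝ (Fin n) → ℝ} (hac : Continuous a) (ha : ∀ x, 1 ≤ a x)
    {u : EuclideanSpace ℝ (Fin n) → ℝ} (hu : AEStronglyMeasurable u volume) :
    Integrable (fun x => a x * |u x| ^ p) ↔
      MemLp (fun x => a x ^ (1 / p) * u x) (ENNReal.ofReal p) volume := by
  have hm : AEStronglyMeasurable (fun x => a x ^ (1 / p) * u x) volume :=
    (hac.rpow_const fun x => Or.inl (by linarith [ha x])).aestronglyMeasurable.mul hu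
  rw [← integrable_norm_rpow_iff hm (by simp; linarith) ENNReal.ofReal_ne_top,
    ENNReal.toReal_ofReal (by linarith)]
  refine integrable_congr (Eventually.of_forall fun x => ?_)
  have h0 : 0 ≤ a x := by linarith [ha x]
  simp only
  rw [norm_mul, Real.mul_rpow (norm_nonneg _) (norm_nonneg _), Real.norm_eq_abs, Real.norm_eq_abs,
    abs_of_nonneg (Real.rpow_nonneg h0 _), ← Real.rpow_mul h0, one_div_mul_cancel (by linarith),
    Real.rpow_one]

/-- The linear subspace of those `u ∈ W^{1,p}(ℝⁿ)` with `∫ a |u|^p < ∞`. -/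
def weightedSubmodule {n : ℕ} {p : ℝ} (hp : 1 ≤ p) (a : C(EuclideanSpace ℝ (Fin n), ℝ))
    (ha : ∀ x, 1 ≤ a x) : Submodule ℝ (sobolevW1p n p) where
  carrier := {u | Integrable fun x => a x * |u.1 x| ^ p}
  add_mem' := by
    intro u v hu hv
    simp only [mem_ofPred_eq] at *
    rw [integrable_weight_iff hp a.continuous ha (Lp.aestronglyMeasurable _)] at *
    refine (hu.add hv).ae_eq ?_
    filter_upwards [Lp.coeFn_add u.1 v.1] with x hx
    rw [Submodule.coe_add, hx]
    simp [mul_add]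
  zero_mem' := by
    simp only [mem_ofPred_eq]
    rw [integrable_weight_iff hp a.continuous ha (Lp.aestronglyMeasurable _)]
    refine MemLp.zero.ae_eq (f := fun _ => (0 : ℝ)) ?_
    filter_upwards [Lp.coeFn_zero ℝ (ENNReal.ofReal p)
      (volume : Measure (EuclideanSpace ℝ (Fin n)))] with x hx
    rw [Submodule.coe_zero, hx]
    simp
  smul_mem' := by
    intro c u hu
    simp only [mem_ofPred_eq] at *
    rw [integrable_weight_iff hp a.continuous ha (Lp.aestronglyMeasurable _)] at *
    refine (hu.const_mul c).ae_eq ?_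
    filter_upwards [Lp.coeFn_smul c u.1] with x hx
    rw [Submodule.coe_smul, hx]
    simp
    ring

/-- The weighted space `E = {u ∈ W^{1,p}(ℝⁿ) : ∫ a |u|^p < ∞}` for a continuous weight `a ≥ 1`.
It is a type of its own, so that it carries the norm below and not the one of `L^p`. -/
def WeightedSobolev {n : ℕ} {p : ℝ} (hp : 1 ≤ p) (a : C(EuclideanSpace ℝ (Fin n), ℝ))
    (ha : ∀ x, 1 ≤ a x) : Type :=
  weightedSubmodule hp a ha

namespace WeightedSobolev

variable {n : ℕ} {p : ℝ} {hp : 1 ≤ p} {a : C(EuclideanSpace ℝ (Fin n), ℝ)} {ha : ∀ x, 1 ≤ a x}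

noncomputable instance : AddCommGroup (WeightedSobolev hp a ha) :=
  inferInstanceAs (AddCommGroup (weightedSubmodule hp a ha))

noncomputable instance : Module ℝ (WeightedSobolev hp a ha) :=
  inferInstanceAs (Module ℝ (weightedSubmodule hp a ha))

/-- The element of `W^{1,p}(ℝⁿ)` underlying `u ∈ E`. -/
def toW1p (u : WeightedSobolev hp a ha) : sobolevW1p n p := Subtype.val u

/-- The function on `ℝⁿ` (a representative of its class) underlying `u ∈ E`. -/
noncomputable def toFun (u : WeightedSobolev hp a ha) : EuclideanSpace ℝ (Fin n) → ℝ := u.toW1p.1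

/-- The weak gradient of `u ∈ E`. -/
noncomputable def grad (u : WeightedSobolev hp a ha) :
    EuclideanSpace ℝ (Fin n) → EuclideanSpace ℝ (Fin n) := weakGrad u.toW1p

/-- `‖u‖_E = (∫ |∇u|^p + a |u|^p)^{1/p}`. -/
noncomputable instance : Norm (WeightedSobolev hp a ha) :=
  ⟨fun u => (∫ x, (‖u.grad x‖ ^ p + a x * |u.toFun x| ^ p)) ^ (1 / p)⟩

theorem norm_def (u : WeightedSobolev hp a ha) :
    ‖u‖ = (∫ x, (‖u.grad x‖ ^ p + a x * |u.toFun x| ^ p)) ^ (1 / p) := rfl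

theorem memLp_toFun (u : WeightedSobolev hp a ha) :
    MemLp u.toFun (ENNReal.ofReal p) volume := Lp.memLp u.toW1p.1

theorem memLp_weight (u : WeightedSobolev hp a ha) :
    MemLp (fun x => a x ^ (1 / p) * u.toFun x) (ENNReal.ofReal p) volume :=
  (integrable_weight_iff hp a.continuous ha (memLp_toFun u).1).1 u.2

theorem toFun_add (u v : WeightedSobolev hp a ha) :
    (u + v).toFun =ᵐ[volume] u.toFun + v.toFun := Lp.coeFn_add u.toW1p.1 v.toW1p.1

theorem toFun_smul (c : ℝ) (u : WeightedSobolev hp a ha) :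
    (c • u).toFun =ᵐ[volume] c • u.toFun := Lp.coeFn_smul c u.toW1p.1

theorem grad_add (u v : WeightedSobolev hp a ha) :
    (u + v).grad =ᵐ[volume] u.grad + v.grad :=
  (isWeakGradient_weakGrad (u + v).toW1p).ae_unique
    (((isWeakGradient_weakGrad u.toW1p).add (isWeakGradient_weakGrad v.toW1p)).congr
      (toFun_add u v).symm)

theorem grad_smul (c : ℝ) (u : WeightedSobolev hp a ha) :
    (c • u).grad =ᵐ[volume] c • u.grad :=
  (isWeakGradient_weakGrad (c • u).toW1p).ae_unique
    (((isWeakGradient_weakGrad u.toW1p).smul c).congr (toFun_smul c u).symm)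

/-- The pair `(∇u, a^{1/p} u)`, whose `L^p` norm is `‖u‖_E`. -/
noncomputable def pair (u : WeightedSobolev hp a ha) (x : EuclideanSpace ℝ (Fin n)) :
    WithLp (ENNReal.ofReal p) (EuclideanSpace ℝ (Fin n) × ℝ) :=
  WithLp.toLp _ (u.grad x, a x ^ (1 / p) * u.toFun x)

theorem norm_pair_rpow [Fact (1 ≤ ENNReal.ofReal p)] (u : WeightedSobolev hp a ha) (x : EuclideanSpace ℝ (Fin n)) :
    ‖u.pair x‖ ^ p = ‖u.grad x‖ ^ p + a x * |u.toFun x| ^ p := by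
  have h0 : 0 ≤ a x := by linarith [ha x]
  have hp0 : 0 < p := by linarith
  rw [WithLp.prod_norm_eq_add (by rw [ENNReal.toReal_ofReal hp0.le]; exact hp0),
    ENNReal.toReal_ofReal hp0.le, ← Real.rpow_mul (by positivity), one_div_mul_cancel hp0.ne',
    Real.rpow_one]
  have h1 : (u.pair x).fst = u.grad x := rfl
  have h2 : (u.pair x).snd = a x ^ (1 / p) * u.toFun x := rfl
  rw [h1, h2, norm_mul, Real.mul_rpow (norm_nonneg _) (norm_nonneg _), Real.norm_eq_abs, Real.norm_eq_abs,
    abs_of_nonneg (Real.rpow_nonneg h0 _), ← Real.rpow_mul h0, one_div_mul_cancel hp0.ne',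
    Real.rpow_one]

theorem memLp_pair [Fact (1 ≤ ENNReal.ofReal p)] (u : WeightedSobolev hp a ha) :
    MemLp u.pair (ENNReal.ofReal p) volume := by
  have hm : AEStronglyMeasurable u.pair volume :=
    (WithLp.prod_continuous_toLp (ENNReal.ofReal p) (EuclideanSpace ℝ (Fin n))
      ℝ).comp_aestronglyMeasurable
      ((memLp_weakGrad u.toW1p).1.prodMk (memLp_weight u).1)
  rw [← integrable_norm_rpow_iff hm (by simp; linarith) ENNReal.ofReal_ne_top,
    ENNReal.toReal_ofReal (by linarith)]
  simp only [norm_pair_rpow]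
  refine Integrable.add ?_ u.2
  have := (memLp_weakGrad u.toW1p).integrable_norm_rpow (by simp; linarith) ENNReal.ofReal_ne_top
  rwa [ENNReal.toReal_ofReal (by linarith)] at this

theorem ofReal_norm [Fact (1 ≤ ENNReal.ofReal p)] (u : WeightedSobolev hp a ha) :
    ENNReal.ofReal ‖u‖ = eLpNorm u.pair (ENNReal.ofReal p) volume := by
  rw [u.memLp_pair.eLpNorm_eq_integral_rpow_norm (by simp; linarith) ENNReal.ofReal_ne_top,
    ENNReal.toReal_ofReal (by linarith), norm_def]
  simp only [norm_pair_rpow, one_div]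

theorem norm_eq [Fact (1 ≤ ENNReal.ofReal p)] (u : WeightedSobolev hp a ha) :
    ‖u‖ = (eLpNorm u.pair (ENNReal.ofReal p) volume).toReal := by
  rw [← ofReal_norm, ENNReal.toReal_ofReal]
  rw [norm_def]
  refine Real.rpow_nonneg (integral_nonneg fun x => ?_) _
  have : 0 ≤ a x := by linarith [ha x]
  positivity

theorem pair_add (u v : WeightedSobolev hp a ha) :
    (u + v).pair =ᵐ[volume] u.pair + v.pair := by
  filter_upwards [toFun_add u v, grad_add u v] with x h1 h2
  simp only [pair, h1, h2, Pi.add_apply, mul_add]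
  rfl

theorem pair_smul (c : ℝ) (u : WeightedSobolev hp a ha) :
    (c • u).pair =ᵐ[volume] c • u.pair := by
  filter_upwards [toFun_smul c u, grad_smul c u] with x h1 h2
  simp only [pair, h1, h2, Pi.smul_apply, smul_eq_mul]
  rw [mul_left_comm]
  rfl

theorem normedSpaceCore : NormedSpace.Core ℝ (WeightedSobolev hp a ha) where
  norm_nonneg u := by
    have : Fact (1 ≤ ENNReal.ofReal p) := ⟨by simpa using hp⟩
    rw [norm_eq]; exact ENNReal.toReal_nonneg
  norm_smul c u := by
    have : Fact (1 ≤ ENNReal.ofReal p) := ⟨by simpa using hp⟩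
    rw [norm_eq, norm_eq, eLpNorm_congr_ae (pair_smul c u), eLpNorm_const_smul]
    simp
  norm_triangle u v := by
    have : Fact (1 ≤ ENNReal.ofReal p) := ⟨by simpa using hp⟩
    rw [norm_eq, norm_eq, norm_eq, eLpNorm_congr_ae (pair_add u v),
      ← ENNReal.toReal_add u.memLp_pair.eLpNorm_ne_top v.memLp_pair.eLpNorm_ne_top]
    exact ENNReal.toReal_mono
      (ENNReal.add_ne_top.2 ⟨u.memLp_pair.eLpNorm_ne_top, v.memLp_pair.eLpNorm_ne_top⟩)
      (eLpNorm_add_le u.memLp_pair.1 v.memLp_pair.1 Fact.out)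
  norm_eq_zero_iff u := by
    have : Fact (1 ≤ ENNReal.ofReal p) := ⟨by simpa using hp⟩
    constructor
    · intro h
      rw [norm_eq, ENNReal.toReal_eq_zero_iff, or_iff_left u.memLp_pair.eLpNorm_ne_top,
        eLpNorm_eq_zero_iff u.memLp_pair.1 (by simp; linarith)] at h
      refine Subtype.ext (Subtype.ext ((Lp.eq_zero_iff_ae_eq_zero).2 ?_))
      filter_upwards [h] with x hx
      have h2 : a x ^ (1 / p) * u.toFun x = 0 := congrArg (fun z => z.snd) hx
      have h3 : 0 < a x ^ (1 / p) := Real.rpow_pos_of_pos (by linarith [ha x]) _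
      exact (mul_eq_zero.1 h2).resolve_left h3.ne'
    · rintro rfl
      have := pair_smul (0 : ℝ) (0 : WeightedSobolev hp a ha)
      rw [zero_smul, zero_smul] at this
      rw [norm_eq, eLpNorm_congr_ae this]
      simp

noncomputable instance : NormedAddCommGroup (WeightedSobolev hp a ha) :=
  NormedAddCommGroup.ofCore normedSpaceCore

noncomputable instance : NormedSpace ℝ (WeightedSobolev hp a ha) :=
  NormedSpace.ofCore normedSpaceCore

end WeightedSobolev

/-! The map u ↦ (∇u, a^{1/p} u) embeds E isometrically in an L^p space of vector-valued functions.
Its range is cut out by the weak gradient identities, each an equality between continuous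
functionals of the pair, so the range is closed and E is complete. Since p ≥ 2, Clarkson's
inequality holds pointwise and, after integration, in E. Hence E is uniformly convex, and reflexive
by Milman–Pettis.

For the embeddings, write u = a^{-1/p} · (a^{1/p} u). Condition (*) says that a^{-1/p} is in
L^{2p/(p-2)}, so Hölder's inequality bounds ‖u‖_2 by ‖u‖_E. At the other end, the
Gagliardo–Nirenberg–Sobolev inequality bounds the L^{p*} norm by ‖∇u‖_p with a constant that ignores
the weight; interpolation gives every r in between. For small ε one has a_ε ≥ a_0 / 2, which makes
the constants independent of ε. The image is dense because it contains all test functions. The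
Sobolev and translation estimates are proved for C^1 functions and pass to u by Fatou's lemma along
mollifications.

Compactness is shown first in L^2. Outside a large bounded set B, Hölder's inequality and the small
tail of a^{-1/p} make ‖u‖_2 uniformly small on the unit ball of E. On B, u is replaced by its means
over small balls around finitely many centres; this is a finite-rank operation, and its error is
controlled by ‖u(· + z) - u‖_p ≤ |z| ‖∇u‖_p. The inclusion is thus a norm limit of finite-rank
operators. For r < p* the interpolation inequality contains a positive power of ‖u‖_2, which
transfers compactness to L^r. -/

section UniformlyConvex

/-! ### Reflexivity of uniformly convex spaces -/

variable {E : Type*} [NormedAddCommGroup E] [NormedSpace ℝ E]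

/-- Helly's theorem: a functional in the closed unit ball of the bidual is approximated on finitely
many elements of the dual by an element of the closed unit ball. -/
theorem exists_norm_le_one_forall_abs_sub_le (ξ : StrongDual ℝ (StrongDual ℝ E)) (hξ : ‖ξ‖ ≤ 1)
    {m : ℕ} (f : Fin m → StrongDual ℝ E) {δ : ℝ} (hδ : 0 < δ) :
    ∃ x : E, ‖x‖ ≤ 1 ∧ ∀ i, |f i x - ξ (f i)| ≤ δ := by
  let T : E →L[ℝ] (Fin m → ℝ) := ContinuousLinearMap.pi f
  by_cases hmem : (fun i => ξ (f i)) ∈ closure (T '' Metric.closedBall 0 1)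
  · obtain ⟨_, ⟨x, hx, rfl⟩, hd⟩ := Metric.mem_closure_iff.1 hmem δ hδ
    refine ⟨x, by simpa using hx, fun i => ?_⟩
    have := (dist_le_pi_dist (fun i => ξ (f i)) (T x) i).trans hd.le
    rwa [dist_comm, Real.dist_eq] at this
  -- A functional φ separating the point from the image of the ball pulls back to a combination g of
  -- the `f i` with ‖g‖ ≤ u < ξ g, against ‖ξ‖ ≤ 1.
  · exfalso
    obtain ⟨φ, u, hφ, hu⟩ := geometric_hahn_banach_closed_point
      ((convex_closedBall (0 : E) 1).linear_image T.toLinearMap).closure isClosed_closure hmem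
    have hrep : ∀ v : Fin m → ℝ, φ v = ∑ i, v i * φ (Pi.single i 1) := fun v => by
      conv_lhs => rw [pi_eq_sum_univ' v]
      simp [map_sum]
    let g : StrongDual ℝ E := ∑ i, φ (Pi.single i 1) • f i
    have hg : ∀ x, g x = φ (T x) := fun x => by
      rw [hrep]
      simp [g, T, mul_comm]
    have hξg : ξ g = φ (fun i => ξ (f i)) := by
      rw [hrep]
      simp [g, map_sum, mul_comm]
    have hlt : ∀ x : E, ‖x‖ ≤ 1 → g x < u := fun x hx => by
      rw [hg]
      exact hφ _ (subset_closure ⟨x, by simpa using hx, rfl⟩)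
    have hu0 : 0 ≤ u := by simpa using (hlt 0 (by simp)).le
    have hgn : ‖g‖ ≤ u := by
      refine ContinuousLinearMap.opNorm_le_of_unit_norm hu0 fun x hx => ?_
      rw [Real.norm_eq_abs, abs_le]
      have h1 := hlt x hx.le
      have h2 := hlt (-x) (by simp [hx])
      rw [map_neg] at h2
      constructor <;> linarith
    have h3 : ξ g ≤ ‖g‖ := (le_abs_self _).trans
      ((ξ.le_opNorm g).trans (mul_le_of_le_one_left (norm_nonneg _) hξ))
    rw [← hξg] at hu
    linarith

theorem mem_of_forall_norm_eq_one (S : Submodule ℝ E) (h : ∀ x : E, ‖x‖ = 1 → x ∈ S) (x : E) :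
    x ∈ S := by
  by_cases h0 : x = 0
  · simp [h0]
  · have := S.smul_mem ‖x‖ (h (‖x‖⁻¹ • x) (norm_smul_inv_norm (𝕜 := ℝ) h0))
    rwa [smul_inv_smul₀ (norm_ne_zero_iff.2 h0)] at this

/-- The **Milman–Pettis theorem**: a uniformly convex Banach space is reflexive. -/
theorem surjective_inclusionInDoubleDual_of_uniformConvexSpace [CompleteSpace E]
    [UniformConvexSpace E] :
    Function.Surjective (NormedSpace.inclusionInDoubleDual ℝ E) := by
  have hunit : ∀ ξ : StrongDual ℝ (StrongDual ℝ E), ‖ξ‖ = 1 →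
      ξ ∈ Set.range (NormedSpace.inclusionInDoubleDual ℝ E) := by
    intro ξ hξ
    have hcl : IsClosed (Set.range (NormedSpace.inclusionInDoubleDual ℝ E)) := by
      have hiso : Isometry (NormedSpace.inclusionInDoubleDual ℝ E) :=
        (NormedSpace.inclusionInDoubleDualLi (E := E) ℝ).isometry
      exact hiso.isClosedEmbedding.isClosed_range
    refine hcl.closure_subset 
      ((Metric.mem_closure_iff (α := StrongDual ℝ (StrongDual ℝ E))).2 fun ε hε => ?_)
    obtain ⟨δ, hδ, hconv⟩ := exists_forall_closed_ball_dist_add_le_two_sub E (half_pos hε)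
    -- A functional f that almost norms ξ. Any two points of the unit ball at which f is within δ/8
    -- of ξ f satisfy f (x + y) > 2 - 3δ/4, so uniform convexity forces them to be within ε/2 of
    -- each other.
    obtain ⟨f, hf1, hf⟩ : ∃ f : StrongDual ℝ E, ‖f‖ ≤ 1 ∧ 1 - δ / 4 < ξ f := by
      by_contra! hcon
      have : ‖ξ‖ ≤ max (1 - δ / 4) 0 := by
        refine ContinuousLinearMap.opNorm_le_of_unit_norm (le_max_right _ _) fun f hf => ?_
        refine le_trans ?_ (le_max_left _ _)
        rw [Real.norm_eq_abs, abs_le]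
        have h1 := hcon f hf.le
        have h2 := hcon (-f) (by simp [hf])
        rw [map_neg] at h2
        constructor <;> linarith
      rw [hξ] at this
      rcases le_max_iff.1 this with h | h <;> linarith
    -- The point x depends on f only. For each g a second point y, adapted to both f and g, is
    -- compared with x; this bounds the error at g uniformly over unit g.
    obtain ⟨x, hx, hfx⟩ := exists_norm_le_one_forall_abs_sub_le ξ hξ.le ![f]
      (by positivity : 0 < δ / 8)
    refine ⟨_, ⟨x, rfl⟩, ?_⟩
    refine (dist_eq_norm (E := StrongDual ℝ (StrongDual ℝ E)) _ _).trans_lt ?_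
    refine lt_of_le_of_lt ?_ (half_lt_self hε)
    refine ContinuousLinearMap.opNorm_le_of_unit_norm (by positivity) fun g hg => ?_
    refine le_of_forall_pos_le_add fun η hη => ?_
    obtain ⟨y, hy, hfy⟩ := exists_norm_le_one_forall_abs_sub_le ξ hξ.le ![f, g]
      (lt_min (by positivity : 0 < δ / 8) hη)
    have hgy : |g y - ξ g| ≤ η := (hfy 1).trans (min_le_right _ _)
    have hfy : |f y - ξ f| ≤ δ / 8 := (hfy 0).trans (min_le_left _ _)
    have hfx : |f x - ξ f| ≤ δ / 8 := hfx 0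
    have hxy : ‖x - y‖ ≤ ε / 2 := by
      by_contra! hlt
      have h1 := hconv hx hy hlt.le
      have h2 : f (x + y) ≤ ‖x + y‖ := (le_abs_self _).trans
        ((f.le_opNorm _).trans (mul_le_of_le_one_left (norm_nonneg _) hf1))
      rw [map_add] at h2
      have h3 := abs_le.1 hfx
      have h4 := abs_le.1 hfy
      linarith [h3.1, h4.1]
    have h5 : |g x - g y| ≤ ε / 2 := by
      rw [← map_sub]
      refine (g.le_opNorm _).trans ?_
      rw [hg, one_mul]
      exact hxy
    rw [sub_apply, NormedSpace.dual_def, Real.norm_eq_abs, abs_sub_comm]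
    calc |g x - ξ g| ≤ |g x - g y| + |g y - ξ g| := abs_sub_le _ _ _
      _ ≤ ε / 2 + η := add_le_add h5 hgy
  intro ξ
  have := mem_of_forall_norm_eq_one (E := StrongDual ℝ (StrongDual ℝ E))
    (LinearMap.range (NormedSpace.inclusionInDoubleDual ℝ E).toLinearMap) hunit ξ
  exact this

end UniformlyConvex

/-! ### Clarkson's inequality and uniform convexity of E -/

/-- Clarkson's inequality with an exponent `p > 0` implies uniform convexity. -/
theorem uniformConvexSpace_of_rpow_add_rpow_le {E : Type*} [NormedAddCommGroup E] {p : ℝ} (hp : 0 < p)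
    (h : ∀ x y : E, ‖x + y‖ ^ p + ‖x - y‖ ^ p ≤ 2 ^ (p - 1) * (‖x‖ ^ p + ‖y‖ ^ p)) :
    UniformConvexSpace E := by
  refine ⟨fun ε hε => ?_⟩
  -- For unit vectors the right side of Clarkson's inequality is 2^p, so ‖x + y‖^p ≤ 2^p - ε^p. The
  -- maximum with 0 covers ε > 2.
  set M : ℝ := max (2 ^ p - ε ^ p) 0
  have hM : M < 2 ^ p := max_lt (by linarith [Real.rpow_pos_of_pos hε p]) (by positivity)
  refine ⟨2 - M ^ p⁻¹, ?_, fun x hx y hy hxy => ?_⟩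
  · rw [sub_pos]
    have := Real.rpow_lt_rpow (le_max_right _ _) hM (inv_pos.2 hp)
    rwa [Real.rpow_rpow_inv (by norm_num) hp.ne'] at this
  · rw [sub_sub_cancel, Real.le_rpow_inv_iff_of_pos (norm_nonneg _) (le_max_right _ _) hp]
    refine le_trans ?_ (le_max_left _ _)
    have h1 := h x y
    have h2 := Real.rpow_le_rpow hε.le hxy hp.le
    have h3 : (2 : ℝ) ^ (p - 1) * 2 = 2 ^ p := by
      rw [Real.rpow_sub_one (by norm_num)]; ring
    rw [hx, hy, Real.one_rpow] at h1
    linarith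

/-- Clarkson's inequality in an inner product space. -/
theorem rpow_norm_add_add_rpow_norm_sub_le {H : Type*} [NormedAddCommGroup H]
    [InnerProductSpace ℝ H] {p : ℝ} (hp : 2 ≤ p) (x y : H) :
    ‖x + y‖ ^ p + ‖x - y‖ ^ p ≤ 2 ^ (p - 1) * (‖x‖ ^ p + ‖y‖ ^ p) := by
  have hq : 1 ≤ p / 2 := by linarith
  have hsq : ∀ t : ℝ, 0 ≤ t → (t ^ 2) ^ (p / 2) = t ^ p := fun t ht => by
    rw [← Real.rpow_natCast, ← Real.rpow_mul ht]
    congr 1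
    push_cast
    ring
  have hpar : ‖x + y‖ ^ 2 + ‖x - y‖ ^ 2 = 2 * (‖x‖ ^ 2 + ‖y‖ ^ 2) := by
    have := parallelogram_law_with_norm ℝ x y
    nlinarith
  -- Superadditivity of t ↦ t^{p/2} on the left, the parallelogram law, then convexity of the same
  -- power on the right; the constants multiply to 2^{p/2} · 2^{p/2 - 1} = 2^{p - 1}.
  have h1 := Real.add_rpow_le_rpow_add (sq_nonneg ‖x + y‖) (sq_nonneg ‖x - y‖) hq
  have h2 : (‖x‖ ^ 2 + ‖y‖ ^ 2) ^ (p / 2) ≤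
      2 ^ (p / 2 - 1) * ((‖x‖ ^ 2) ^ (p / 2) + (‖y‖ ^ 2) ^ (p / 2)) := by
    have := NNReal.rpow_add_le_mul_rpow_add_rpow (‖x‖₊ ^ 2) (‖y‖₊ ^ 2) hq
    rw [← NNReal.coe_le_coe] at this
    simpa using this
  rw [hpar, Real.mul_rpow (by norm_num) (by positivity)] at h1
  simp only [hsq _ (norm_nonneg _)] at h1 h2
  refine h1.trans ((mul_le_mul_of_nonneg_left h2 (by positivity)).trans_eq ?_)
  rw [← mul_assoc, ← Real.rpow_add (by norm_num)]
  congr 2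
  ring

namespace WeightedSobolev

variable {n : ℕ} {p : ℝ} {hp : 1 ≤ p} {a : C(EuclideanSpace ℝ (Fin n), ℝ)} {ha : ∀ x, 1 ≤ a x}

theorem integrable_grad_rpow (u : WeightedSobolev hp a ha) :
    Integrable fun x => ‖u.grad x‖ ^ p := by
  have := (memLp_weakGrad u.toW1p).integrable_norm_rpow (by simp; linarith) ENNReal.ofReal_ne_top
  rwa [ENNReal.toReal_ofReal (by linarith)] at this

theorem integrable_weight (u : WeightedSobolev hp a ha) :
    Integrable fun x => a x * |u.toFun x| ^ p := u.2

theorem norm_rpow (u : WeightedSobolev hp a ha) :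
    ‖u‖ ^ p = ∫ x, (‖u.grad x‖ ^ p + a x * |u.toFun x| ^ p) := by
  rw [norm_def, ← Real.rpow_mul, one_div_mul_cancel (by linarith), Real.rpow_one]
  refine integral_nonneg fun x => ?_
  have : 0 ≤ a x := by linarith [ha x]
  positivity

theorem toFun_sub (u v : WeightedSobolev hp a ha) :
    (u - v).toFun =ᵐ[volume] u.toFun - v.toFun := Lp.coeFn_sub u.toW1p.1 v.toW1p.1

theorem grad_sub (u v : WeightedSobolev hp a ha) :
    (u - v).grad =ᵐ[volume] u.grad - v.grad := by
  have h1 := grad_add u ((-1 : ℝ) • v)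
  rw [neg_one_smul, ← sub_eq_add_neg] at h1
  filter_upwards [h1, grad_smul (-1) v] with x hx hy
  rw [neg_one_smul] at hy
  rw [hx, Pi.add_apply, hy]
  simp [sub_eq_add_neg]

/-- The p-th power of the norm is an integral, so Clarkson's inequality may be applied pointwise, to
the gradients in ℝⁿ and to the values in ℝ with weight a, and then integrated. -/
theorem uniformConvexSpace (hp2 : 2 ≤ p) : UniformConvexSpace (WeightedSobolev hp a ha) := by
  refine uniformConvexSpace_of_rpow_add_rpow_le (p := p) (by linarith) fun u v => ?_
  have hi : ∀ u : WeightedSobolev hp a ha,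
      Integrable fun x => ‖u.grad x‖ ^ p + a x * |u.toFun x| ^ p :=
    fun u => u.integrable_grad_rpow.add u.integrable_weight
  simp only [norm_rpow]
  rw [← integral_add (hi _) (hi _), ← integral_add (hi _) (hi _), ← integral_const_mul]
  refine integral_mono_ae ((hi _).add (hi _)) (((hi _).add (hi _)).const_mul _) ?_
  filter_upwards [toFun_add u v, toFun_sub u v, grad_add u v, grad_sub u v] with x h1 h2 h3 h4
  simp only [Pi.add_apply, h1, h2, h3, h4, Pi.sub_apply]
  have h5 := rpow_norm_add_add_rpow_norm_sub_le hp2 (u.grad x) (v.grad x)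
  have h6 := mul_le_mul_of_nonneg_left
    (rpow_norm_add_add_rpow_norm_sub_le hp2 (u.toFun x) (v.toFun x)) (zero_le_one.trans (ha x))
  simp only [Real.norm_eq_abs] at h6
  linarith

end WeightedSobolev

/-! ### Completeness of E -/

theorem continuous_integral_mul_clm_comp_Lp {X V : Type*} [TopologicalSpace X]
    [MeasurableSpace X] [OpensMeasurableSpace X] {μ : Measure X} [IsFiniteMeasureOnCompacts μ]
    [NormedAddCommGroup V] [NormedSpace ℝ V] {q : ℝ≥0∞} [Fact (1 ≤ q)] {ψ : X → ℝ}
    (hψ : Continuous ψ) (hc : HasCompactSupport ψ) (L : V →L[ℝ] ℝ) :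
    Continuous fun U : Lp V q μ => ∫ x, ψ x * L (U x) ∂μ := by
  -- A continuous function with compact support lies in the space with the conjugate exponent, so
  -- the integral is a Hölder pairing.
  have hψm : MemLp ψ (ENNReal.conjExponent q) μ := hψ.memLp_of_hasCompactSupport hc
  have : Fact (1 ≤ ENNReal.conjExponent q) :=
    ⟨(ENNReal.HolderConjugate.symm (p := q)).one_le⟩
  have : ENNReal.HolderConjugate (ENNReal.conjExponent q) q := ENNReal.HolderConjugate.symm
  convert (((ContinuousLinearMap.mul ℝ ℝ).lpPairing μ (ENNReal.conjExponent q) q)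
    hψm.toLp ∘L L.compLpL q μ).continuous using 2 with U
  rw [ContinuousLinearMap.comp_apply, ContinuousLinearMap.lpPairing_eq_integral]
  refine integral_congr_ae ?_
  filter_upwards [hψm.coeFn_toLp, L.coeFn_compLpL U] with x h1 h2
  rw [h1, h2, ContinuousLinearMap.mul_apply']

theorem continuous_rpow_of_one_le {X : Type*} [TopologicalSpace X] (a : C(X, ℝ))
    (ha : ∀ x, 1 ≤ a x) (s : ℝ) : Continuous fun x => a x ^ s :=
  a.continuous.rpow_const fun x => Or.inl (by linarith [ha x])

namespace WeightedSobolev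

variable {n : ℕ} {p : ℝ} {hp : 1 ≤ p} {a : C(EuclideanSpace ℝ (Fin n), ℝ)} {ha : ∀ x, 1 ≤ a x}

/-- An element of `E` from a function, a weak gradient, and integrability of the norm. -/
noncomputable def mk' (u : EuclideanSpace ℝ (Fin n) → ℝ)
    (g : EuclideanSpace ℝ (Fin n) → EuclideanSpace ℝ (Fin n))
    (hu : MemLp u (ENNReal.ofReal p) volume) (hg : MemLp g (ENNReal.ofReal p) volume)
    (hug : IsWeakGradient u g) (hau : Integrable fun x => a x * |u x| ^ p) :
    WeightedSobolev hp a ha :=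
  ⟨⟨hu.toLp, g, hg, hug.congr hu.coeFn_toLp.symm⟩, by
    refine hau.congr ?_
    filter_upwards [hu.coeFn_toLp] with x hx
    rw [hx]⟩

theorem toFun_mk' {u : EuclideanSpace ℝ (Fin n) → ℝ}
    {g : EuclideanSpace ℝ (Fin n) → EuclideanSpace ℝ (Fin n)}
    (hu : MemLp u (ENNReal.ofReal p) volume) (hg : MemLp g (ENNReal.ofReal p) volume)
    (hug : IsWeakGradient u g) (hau : Integrable fun x => a x * |u x| ^ p) :
    (mk' u g hu hg hug hau : WeightedSobolev hp a ha).toFun =ᵐ[volume] u :=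
  hu.coeFn_toLp

theorem isWeakGradient (u : WeightedSobolev hp a ha) : IsWeakGradient u.toFun u.grad :=
  isWeakGradient_weakGrad u.toW1p

theorem grad_mk' {u : EuclideanSpace ℝ (Fin n) → ℝ}
    {g : EuclideanSpace ℝ (Fin n) → EuclideanSpace ℝ (Fin n)}
    (hu : MemLp u (ENNReal.ofReal p) volume) (hg : MemLp g (ENNReal.ofReal p) volume)
    (hug : IsWeakGradient u g) (hau : Integrable fun x => a x * |u x| ^ p) :
    (mk' u g hu hg hug hau : WeightedSobolev hp a ha).grad =ᵐ[volume] g :=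
  (isWeakGradient _).ae_unique (hug.congr (toFun_mk' hu hg hug hau).symm)

variable [Fact (1 ≤ ENNReal.ofReal p)]

/-- The isometric embedding `u ↦ (∇u, a^{1/p} u)` of `E` into an `L^p` space. -/
noncomputable def pairHom : WeightedSobolev hp a ha →+
    Lp (WithLp (ENNReal.ofReal p) (EuclideanSpace ℝ (Fin n) × ℝ)) (ENNReal.ofReal p)
      (volume : Measure (EuclideanSpace ℝ (Fin n))) :=
  AddMonoidHom.mk' (fun u => u.memLp_pair.toLp) fun u v => by
    rw [← MemLp.toLp_add]
    exact MemLp.toLp_congr _ _ (pair_add u v)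

theorem isometry_pairHom : Isometry (pairHom : WeightedSobolev hp a ha →+ _) :=
  AddMonoidHomClass.isometry_of_norm _ fun u => by
    rw [norm_eq]
    exact Lp.norm_toLp _ u.memLp_pair

-- A pair (g, w) in L^p comes from E exactly when g is the weak gradient of u = a^{-1/p} w. Nothing
-- else is needed: a ≥ 1 puts u in L^p, and a |u|^p = |w|^p is integrable. The factor a^{-1/p} is
-- placed on the test function so that each condition pairs the element of L^p with a continuous
-- function of compact support.
variable (hp a ha) in
theorem range_pairHom :
    Set.range (pairHom : WeightedSobolev hp a ha →+ _) =
      {U | ∀ φ : EuclideanSpace ℝ (Fin n) → ℝ, ContDiff ℝ ∞ φ → HasCompactSupport φ →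
        ∀ i : Fin n,
          ∫ x, (a x ^ (-(1 / p)) * fderiv ℝ φ x (EuclideanSpace.single i 1)) *
              WithLp.sndL _ ℝ _ _ (U x) =
            -∫ x, φ x * (EuclideanSpace.proj (𝕜 := ℝ) i ∘L WithLp.fstL _ ℝ _ _) (U x)} := by
  have ha0 : ∀ x, 0 < a x := fun x => zero_lt_one.trans_le (ha x)
  have hinv : ∀ x, a x ^ (-(1 / p)) * a x ^ (1 / p) = 1 := fun x => by
    rw [← Real.rpow_add (ha0 x), neg_add_cancel, Real.rpow_zero]
  ext U
  constructor
  · rintro ⟨u, rfl⟩ φ hφ hc i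
    have hU : (pairHom u : _ → _) =ᵐ[volume] u.pair := u.memLp_pair.coeFn_toLp
    have h := u.isWeakGradient.3 φ hφ hc i
    convert h using 1
    · refine integral_congr_ae ?_
      filter_upwards [hU] with x hx
      have : WithLp.sndL (ENNReal.ofReal p) ℝ (EuclideanSpace ℝ (Fin n)) ℝ (u.pair x) =
        a x ^ (1 / p) * u.toFun x := rfl
      rw [hx, this]
      linear_combination (fderiv ℝ φ x (EuclideanSpace.single i 1) * u.toFun x) * hinv x
    · congr 1
      refine integral_congr_ae ?_
      filter_upwards [hU] with x hx
      rw [hx, mul_comm]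
      rfl
  · intro hU
    have hU1 : MemLp (fun x => (U x).fst) (ENNReal.ofReal p) volume := (Lp.memLp U).prodLp_fst
    have hU2 : MemLp (fun x => (U x).snd) (ENNReal.ofReal p) volume := (Lp.memLp U).prodLp_snd
    have hcont := continuous_rpow_of_one_le a ha (-(1 / p))
    have hw : MemLp (fun x => a x ^ (-(1 / p)) * (U x).snd) (ENNReal.ofReal p) volume := by
      refine hU2.mono (hcont.aestronglyMeasurable.mul hU2.1) (Eventually.of_forall fun x => ?_)
      rw [norm_mul, Real.norm_of_nonneg (Real.rpow_nonneg (ha0 x).le _)]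
      exact mul_le_of_le_one_left (norm_nonneg _)
        (Real.rpow_le_one_of_one_le_of_nonpos (ha x) (by
          have : 0 ≤ 1 / p := by positivity
          linarith))
    have hgrad : IsWeakGradient (fun x => a x ^ (-(1 / p)) * (U x).snd)
        (fun x => (U x).fst) := by
      refine ⟨hw.locallyIntegrable Fact.out, hU1.locallyIntegrable Fact.out,
        fun φ hφ hc i => ?_⟩
      convert hU φ hφ hc i using 1
      · refine integral_congr_ae (Eventually.of_forall fun x => ?_)
        have : WithLp.sndL (ENNReal.ofReal p) ℝ (EuclideanSpace ℝ (Fin n)) ℝ (U x) =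
          (U x).snd := rfl
        simp only [this]
        ring
      · congr 1
        refine integral_congr_ae (Eventually.of_forall fun x => ?_)
        exact mul_comm _ _
    have heq : ∀ x, a x ^ (1 / p) * (a x ^ (-(1 / p)) * (U x).snd) = (U x).snd := fun x => by
      rw [← mul_assoc, mul_comm (a x ^ (1 / p)), hinv, one_mul]
    have hint : Integrable fun x => a x * |a x ^ (-(1 / p)) * (U x).snd| ^ p := by
      rw [integrable_weight_iff hp a.continuous ha hw.1]
      simpa only [heq] using hU2
    refine ⟨mk' _ _ hw hU1 hgrad hint, Lp.ext ?_⟩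
    filter_upwards [(memLp_pair (mk' _ _ hw hU1 hgrad hint : WeightedSobolev hp a ha)).coeFn_toLp,
      toFun_mk' (hp := hp) (ha := ha) hw hU1 hgrad hint,
      grad_mk' (hp := hp) (ha := ha) hw hU1 hgrad hint] with x h1 h2 h3
    refine h1.trans ?_
    rw [pair, h2, h3, heq]
    rfl

theorem isClosed_range_pairHom :
    IsClosed (Set.range (pairHom : WeightedSobolev hp a ha →+ _)) := by
  rw [range_pairHom]
  simp only [ofPred_forall]
  refine isClosed_iInter fun φ => isClosed_iInter fun hφ => isClosed_iInter fun hc =>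
    isClosed_iInter fun i => isClosed_eq ?_ ?_
  · exact continuous_integral_mul_clm_comp_Lp
      ((continuous_rpow_of_one_le a ha _).mul
        ((hφ.continuous_fderiv (by simp)).clm_apply continuous_const))
      (HasCompactSupport.mul_left (hc.fderiv_apply ℝ _)) _
  · exact (continuous_integral_mul_clm_comp_Lp hφ.continuous hc _).neg

end WeightedSobolev

theorem WeightedSobolev.completeSpace {n : ℕ} {p : ℝ} {hp : 1 ≤ p}
    {a : C(EuclideanSpace ℝ (Fin n), ℝ)} {ha : ∀ x, 1 ≤ a x} :
    CompleteSpace (WeightedSobolev hp a ha) := by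
  have : Fact (1 ≤ ENNReal.ofReal p) := ⟨by simpa using hp⟩
  exact isometry_pairHom.isUniformInducing.completeSpace isClosed_range_pairHom.isComplete

/-! ### Averages of translates, mollification and translation estimates -/

theorem rpow_lintegral_le_lintegral_rpow {Ω : Type*} [MeasurableSpace Ω] {ν : Measure Ω}
    [IsProbabilityMeasure ν] {p : ℝ} (hp : 1 ≤ p) {f : Ω → ℝ≥0∞} (hf : Measurable f) :
    (∫⁻ y, f y ∂ν) ^ p ≤ ∫⁻ y, f y ^ p ∂ν := by
  have h := eLpNorm'_le_eLpNorm'_of_exponent_le one_pos hp ν hf.aestronglyMeasurable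
  have h0 : 0 < p := by linarith
  simp only [eLpNorm', enorm_eq_self, ENNReal.rpow_one, div_one] at h
  refine (ENNReal.rpow_le_rpow h h0.le).trans_eq ?_
  rw [← ENNReal.rpow_mul, one_div_mul_cancel h0.ne', ENNReal.rpow_one]

/-- Minkowski's integral inequality for an average of functions whose `L^p` norms are bounded. -/
theorem eLpNorm_le_of_enorm_le_lintegral {X Y W : Type*} [MeasurableSpace X] {μ : Measure X}
    [SFinite μ] [MeasurableSpace Y] {ν : Measure Y} [IsProbabilityMeasure ν]
    [NormedAddCommGroup W] {p : ℝ} (hp : 1 ≤ p) {Φ : X → Y → ℝ≥0∞}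
    (hΦ : Measurable (Function.uncurry Φ)) {M : ℝ≥0∞}
    (hM : ∀ᵐ y ∂ν, ∫⁻ x, Φ x y ^ p ∂μ ≤ M ^ p) {F : X → W}
    (hF : ∀ x, ‖F x‖ₑ ≤ ∫⁻ y, Φ x y ∂ν) : eLpNorm F (ENNReal.ofReal p) μ ≤ M := by
  have h0 : 0 < p := by linarith
  have key : ∫⁻ x, ‖F x‖ₑ ^ p ∂μ ≤ M ^ p := calc
    _ ≤ ∫⁻ x, (∫⁻ y, Φ x y ∂ν) ^ p ∂μ :=
      lintegral_mono fun x => ENNReal.rpow_le_rpow (hF x) h0.le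
    _ ≤ ∫⁻ x, ∫⁻ y, Φ x y ^ p ∂ν ∂μ := lintegral_mono fun x =>
      rpow_lintegral_le_lintegral_rpow hp (hΦ.comp measurable_prodMk_left)
    _ = ∫⁻ y, ∫⁻ x, Φ x y ^ p ∂μ ∂ν :=
      lintegral_lintegral_swap (hΦ.pow_const p).aemeasurable
    _ ≤ ∫⁻ _, M ^ p ∂ν := lintegral_mono_ae hM
    _ = M ^ p := by simp
  rw [eLpNorm_eq_lintegral_rpow_enorm_toReal (by simpa using h0) ENNReal.ofReal_ne_top,
    ENNReal.toReal_ofReal h0.le, one_div, ENNReal.rpow_inv_le_iff h0]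
  exact key

theorem lintegral_enorm_rpow_eq_eLpNorm_rpow {X W : Type*} [MeasurableSpace X] (μ : Measure X)
    [NormedAddCommGroup W] {p : ℝ} (hp : 0 < p) (f : X → W) :
    ∫⁻ x, ‖f x‖ₑ ^ p ∂μ = eLpNorm f (ENNReal.ofReal p) μ ^ p := by
  rw [eLpNorm_eq_lintegral_rpow_enorm_toReal (by simpa using hp) ENNReal.ofReal_ne_top,
    ENNReal.toReal_ofReal hp.le, ← ENNReal.rpow_mul, one_div_mul_cancel hp.ne',
    ENNReal.rpow_one]

/-- Averaging translates of a function does not increase its `L^p` norm. -/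
theorem eLpNorm_le_of_enorm_le_lintegral_translate {G Y V W : Type*} [AddCommGroup G]
    [MeasurableSpace G] [MeasurableAdd₂ G] {μ : Measure G} [SFinite μ] [μ.IsAddLeftInvariant]
    [MeasurableSpace Y] {ν : Measure Y} [IsProbabilityMeasure ν]
    [NormedAddCommGroup V] [NormedAddCommGroup W] {p : ℝ} (hp : 1 ≤ p)
    {T : Y → G} (hT : Measurable T) {f : G → V} (hf : StronglyMeasurable f) {F : G → W}
    (c : ℝ≥0∞) (hF : ∀ x, ‖F x‖ₑ ≤ c * ∫⁻ y, ‖f (x + T y)‖ₑ ∂ν) :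
    eLpNorm F (ENNReal.ofReal p) μ ≤ c * eLpNorm f (ENNReal.ofReal p) μ := by
  have h0 : 0 < p := by linarith
  have hm : Measurable fun z : G × Y => ‖f (z.1 + T z.2)‖ₑ :=
    hf.enorm.comp (measurable_fst.add (hT.comp measurable_snd))
  refine eLpNorm_le_of_enorm_le_lintegral (ν := ν) hp (Φ := fun x y => c * ‖f (x + T y)‖ₑ)
    (hm.const_mul c) (Eventually.of_forall fun y => ?_) fun x => (hF x).trans_eq
      (lintegral_const_mul _ (hm.comp measurable_prodMk_left)).symm
  simp only [ENNReal.mul_rpow_of_nonneg _ _ h0.le]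
  have hy : Measurable fun x => ‖f (x + T y)‖ₑ ^ p :=
    (hf.enorm.comp (measurable_add_const _)).pow_const p
  rw [lintegral_const_mul _ hy,
    lintegral_add_right_eq_self (fun x => ‖f x‖ₑ ^ p) (T y),
    lintegral_enorm_rpow_eq_eLpNorm_rpow μ h0]

/-- Mollification does not increase the `L^p` norm. -/
theorem eLpNorm_integral_smul_sub_le {n : ℕ} {V : Type*} [NormedAddCommGroup V] [NormedSpace ℝ V]
    {p : ℝ} (hp : 1 ≤ p) {φ : EuclideanSpace ℝ (Fin n) → ℝ} (hφ : Continuous φ)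
    (hφ0 : ∀ x, 0 ≤ φ x) (hφi : Integrable φ) (hφ1 : ∫ x, φ x = 1)
    {f : EuclideanSpace ℝ (Fin n) → V} (hf : AEStronglyMeasurable f volume) :
    eLpNorm (fun x => ∫ t, φ (x - t) • f t) (ENNReal.ofReal p) volume ≤
      eLpNorm f (ENNReal.ofReal p) volume := by
  have hφm : Measurable fun x => ENNReal.ofReal (φ x) := hφ.measurable.ennreal_ofReal
  -- With ν = φ dx the mollification is a ν-average of the translates f(x - y).
  let ν : Measure (EuclideanSpace ℝ (Fin n)) :=
    volume.withDensity fun x => ENNReal.ofReal (φ x)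
  have hν : IsProbabilityMeasure ν := ⟨by
    rw [withDensity_apply _ MeasurableSet.univ, setLIntegral_univ,
      ← ofReal_integral_eq_lintegral_ofReal hφi (Eventually.of_forall hφ0), hφ1,
      ENNReal.ofReal_one]⟩
  have hsm := hf.stronglyMeasurable_mk
  rw [eLpNorm_congr_ae hf.ae_eq_mk, ← one_mul (eLpNorm (hf.mk f) _ _)]
  refine eLpNorm_le_of_enorm_le_lintegral_translate (ν := ν) hp (measurable_neg) hsm 1
    fun x => ?_
  have h1 : ∫ t, φ (x - t) • f t = ∫ t, φ t • hf.mk f (x - t) := by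
    rw [← integral_sub_left_eq_self (fun t => φ t • hf.mk f (x - t)) volume x]
    refine integral_congr_ae ?_
    filter_upwards [hf.ae_eq_mk] with t ht
    rw [sub_sub_cancel, ht]
  have hm2 : Measurable fun y => ‖hf.mk f (x + -y)‖ₑ :=
    hsm.enorm.comp (measurable_neg.const_add x)
  have h2 : ∫⁻ y, ‖hf.mk f (x + -y)‖ₑ ∂ν = _ :=
    lintegral_withDensity_eq_lintegral_mul volume hφm hm2
  rw [h1, one_mul, h2]
  refine (enorm_integral_le_lintegral_enorm _).trans_eq ?_
  congr 1 with t
  rw [enorm_smul, Real.enorm_of_nonneg (hφ0 t), Pi.mul_apply, ← sub_eq_add_neg]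

theorem clm_ext_single {n : ℕ} {A B : EuclideanSpace ℝ (Fin n) →L[ℝ] ℝ}
    (h : ∀ i, A (EuclideanSpace.single i 1) = B (EuclideanSpace.single i 1)) : A = B := by
  have h1 : A.toLinearMap = B.toLinearMap :=
    (EuclideanSpace.basisFun (Fin n) ℝ).toBasis.ext fun i => by simpa using h i
  ext w
  exact congrArg (fun L : EuclideanSpace ℝ (Fin n) →ₗ[ℝ] ℝ => L w) h1

/-- The derivative of a mollification is the mollification of the weak gradient. -/
theorem IsWeakGradient.hasFDerivAt_convolution {n : ℕ} {u : EuclideanSpace ℝ (Fin n) → ℝ}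
    {g : EuclideanSpace ℝ (Fin n) → EuclideanSpace ℝ (Fin n)} (h : IsWeakGradient u g)
    {φ : EuclideanSpace ℝ (Fin n) → ℝ} (hφ : ContDiff ℝ ∞ φ) (hc : HasCompactSupport φ)
    (x : EuclideanSpace ℝ (Fin n)) :
    HasFDerivAt (convolution φ u (ContinuousLinearMap.lsmul ℝ ℝ) volume)
      (innerSL ℝ (∫ t, φ (x - t) • g t)) x := by
  have hφ1 : ContDiff ℝ 1 φ := hφ.of_le (by exact_mod_cast le_top)
  have hd := hc.hasFDerivAt_convolution_right (ContinuousLinearMap.lsmul ℝ ℝ).flip h.1 hφ1 x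
  rw [convolution_flip] at hd
  -- The weak gradient identity is tested against t ↦ φ(x - t); the chain rule supplies a sign that
  -- cancels the one in the identity.
  have hη : ContDiff ℝ ∞ fun t => φ (x - t) := hφ.comp (contDiff_const.sub contDiff_id)
  have hηc : HasCompactSupport fun t => φ (x - t) :=
    hc.comp_homeomorph (Homeomorph.subLeft x)
  have hgi : Integrable fun t => φ (x - t) • g t :=
    h.2.integrable_smul_left_of_hasCompactSupport hη.continuous hηc
  suffices hD : innerSL ℝ (∫ t, φ (x - t) • g t) = convolution u (fderiv ℝ φ)
      ((ContinuousLinearMap.lsmul ℝ ℝ).flip.precompR (EuclideanSpace ℝ (Fin n))) volume x by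
    rw [hD]
    exact hd
  refine clm_ext_single fun i => ?_
  rw [convolution_precompR_apply _ h.1 (hc.fderiv ℝ) (hφ.continuous_fderiv (by simp)),
    convolution_def, innerSL_apply_apply]
  have h2 := h.3 _ hη hηc i
  have h3 : ∀ t, fderiv ℝ (fun t => φ (x - t)) t (EuclideanSpace.single i 1) =
      -fderiv ℝ φ (x - t) (EuclideanSpace.single i 1) := fun t => by
    have h4 : HasFDerivAt (fun t => φ (x - t))
        ((fderiv ℝ φ (x - t)).comp (-ContinuousLinearMap.id ℝ _)) t :=
      ((hφ1.differentiable one_ne_zero (x - t)).hasFDerivAt).comp t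
        ((hasFDerivAt_id t).const_sub x)
    rw [h4.fderiv]
    simp
  simp only [h3, mul_neg, integral_neg, neg_inj] at h2
  have h5 : inner ℝ (∫ t, φ (x - t) • g t) (EuclideanSpace.single i 1) =
      ∫ t, g t i * φ (x - t) := by
    rw [EuclideanSpace.inner_single_right]
    simp only [one_mul, conj_trivial]
    refine ((EuclideanSpace.proj (𝕜 := ℝ) i).integral_comp_comm hgi).symm.trans ?_
    refine integral_congr_ae (Eventually.of_forall fun t => ?_)
    simp [mul_comm]
  rw [h5, ← h2]
  refine integral_congr_ae (Eventually.of_forall fun t => ?_)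
  simp [mul_comm]

/-- Approximation of a Sobolev function by `C^1` functions which converge almost everywhere and
do not have larger norms. -/
theorem IsWeakGradient.exists_contDiff_tendsto {n : ℕ} {p : ℝ} (hp : 1 ≤ p)
    {u : EuclideanSpace ℝ (Fin n) → ℝ}
    {g : EuclideanSpace ℝ (Fin n) → EuclideanSpace ℝ (Fin n)} (h : IsWeakGradient u g) :
    ∃ v : ℕ → EuclideanSpace ℝ (Fin n) → ℝ, (∀ k, ContDiff ℝ 1 (v k)) ∧
      (∀ k, eLpNorm (v k) (ENNReal.ofReal p) volume ≤ eLpNorm u (ENNReal.ofReal p) volume) ∧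
      (∀ k, eLpNorm (fderiv ℝ (v k)) (ENNReal.ofReal p) volume ≤
        eLpNorm g (ENNReal.ofReal p) volume) ∧
      ∀ᵐ x, Tendsto (fun k => v k x) atTop (𝓝 (u x)) := by
  -- Outer and inner radii keep the fixed ratio 2, the bounded eccentricity required for almost
  -- everywhere convergence of the mollifications of a locally integrable function.
  let φ : ℕ → ContDiffBump (0 : EuclideanSpace ℝ (Fin n)) := fun k =>
    ⟨1 / ((k : ℝ) + 1), 2 * (1 / ((k : ℝ) + 1)), by positivity, by
      have : 0 < 1 / ((k : ℝ) + 1) := by positivity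
      linarith⟩
  have hsm : ∀ k, ContDiff ℝ ∞ ((φ k).normed volume) := fun k => (φ k).contDiff_normed
  have hcs : ∀ k, HasCompactSupport ((φ k).normed volume) := fun k =>
    (φ k).hasCompactSupport_normed
  refine ⟨fun k => convolution ((φ k).normed volume) u (ContinuousLinearMap.lsmul ℝ ℝ) volume,
    fun k => ?_, fun k => ?_, fun k => ?_, ?_⟩
  · exact (hcs k).contDiff_convolution_left (n := 1) _ (φ k).contDiff_normed h.1
  · have := eLpNorm_integral_smul_sub_le hp (hsm k).continuous (fun x => (φ k).nonneg_normed x)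
      (φ k).integrable_normed (φ k).integral_normed h.1.aestronglyMeasurable
    have h2 : convolution ((φ k).normed volume) u (ContinuousLinearMap.lsmul ℝ ℝ) volume =
        fun x => ∫ t, (φ k).normed volume (x - t) • u t := funext fun x =>
      convolution_lsmul_swap
    simpa only [h2] using this
  · refine le_trans (eLpNorm_mono fun x => ?_)
      (eLpNorm_integral_smul_sub_le hp (hsm k).continuous (fun x => (φ k).nonneg_normed x)
        (φ k).integrable_normed (φ k).integral_normed h.2.aestronglyMeasurable)
    rw [(h.hasFDerivAt_convolution (hsm k) (hcs k) x).fderiv, innerSL_apply_norm]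
  · refine ContDiffBump.ae_convolution_tendsto_right_of_locallyIntegrable (K := 2) ?_
      (Eventually.of_forall fun k => le_rfl) h.1
    simpa [φ] using (tendsto_one_div_add_atTop_nhds_zero_nat (𝕜 := ℝ)).const_mul 2

/-- Fatou's lemma, in the form that carries bounds from approximations to their limit. -/
theorem eLpNorm_le_of_ae_tendsto {α V : Type*} [MeasurableSpace α] {μ : Measure α}
    [NormedAddCommGroup V] {q : ℝ≥0∞} {f : ℕ → α → V} {F : α → V} {c : ℕ → ℝ≥0∞} {C : ℝ≥0∞}
    (hf : ∀ k, AEStronglyMeasurable (f k) μ)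
    (hlim : ∀ᵐ x ∂μ, Tendsto (fun k => f k x) atTop (𝓝 (F x)))
    (hc : ∀ k, eLpNorm (f k) q μ ≤ c k) (hC : Tendsto c atTop (𝓝 C)) :
    eLpNorm F q μ ≤ C :=
  (Lp.eLpNorm_lim_le_liminf_eLpNorm hf F hlim).trans
    ((liminf_le_liminf (Eventually.of_forall hc)).trans_eq hC.liminf_eq)

/-- Since v(x + z) - v(x) = ∫₀¹ Dv(x + tz) z dt, the difference is bounded by |z| times an average
of translates of |Dv|. -/
theorem ContDiff.eLpNorm_translate_sub_le {n : ℕ} {p : ℝ} (hp : 1 ≤ p)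
    {v : EuclideanSpace ℝ (Fin n) → ℝ} (hv : ContDiff ℝ 1 v) (z : EuclideanSpace ℝ (Fin n)) :
    eLpNorm (fun x => v (x + z) - v x) (ENNReal.ofReal p) volume ≤
      ‖z‖ₑ * eLpNorm (fderiv ℝ v) (ENNReal.ofReal p) volume := by
  have hcont : Continuous (fderiv ℝ v) := hv.continuous_fderiv one_ne_zero
  have : IsProbabilityMeasure ((volume : Measure ℝ).restrict (Ioc 0 1)) := ⟨by simp⟩
  refine eLpNorm_le_of_enorm_le_lintegral_translate
    (ν := (volume : Measure ℝ).restrict (Ioc 0 1)) (T := fun t => t • z) hp (by fun_prop)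
    hcont.stronglyMeasurable _ fun x => ?_
  have hline : Continuous fun t : ℝ => fderiv ℝ v (x + t • z) z := by fun_prop
  have hftc : ∫ t in (0 : ℝ)..1, fderiv ℝ v (x + t • z) z = v (x + z) - v x := by
    have := intervalIntegral.integral_eq_sub_of_hasDerivAt (a := 0) (b := 1)
      (f := fun t : ℝ => v (x + t • z)) (f' := fun t => fderiv ℝ v (x + t • z) z)
      (fun t _ => by
        have h1 : HasDerivAt (fun t : ℝ => x + t • z) z t := by
          simpa using ((hasDerivAt_id t).smul_const z).const_add x
        exact ((hv.differentiable one_ne_zero _).hasFDerivAt).comp_hasDerivAt t h1)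
      (hline.intervalIntegrable _ _)
    simpa using this
  rw [← hftc, intervalIntegral.integral_of_le zero_le_one,
    ← lintegral_const_mul _ (by fun_prop)]
  refine (enorm_integral_le_lintegral_enorm _).trans (lintegral_mono fun t => ?_)
  rw [mul_comm]
  exact (fderiv ℝ v (x + t • z)).le_opENorm z

/-- Translations of a Sobolev function: `‖u(· + z) - u‖_p ≤ |z| ‖∇u‖_p`. -/
theorem IsWeakGradient.eLpNorm_translate_sub_le {n : ℕ} {p : ℝ} (hp : 1 ≤ p)
    {u : EuclideanSpace ℝ (Fin n) → ℝ}
    {g : EuclideanSpace ℝ (Fin n) → EuclideanSpace ℝ (Fin n)} (h : IsWeakGradient u g)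
    (z : EuclideanSpace ℝ (Fin n)) :
    eLpNorm (fun x => u (x + z) - u x) (ENNReal.ofReal p) volume ≤
      ‖z‖ₑ * eLpNorm g (ENNReal.ofReal p) volume := by
  obtain ⟨v, hv1, -, hv3, hv4⟩ := h.exists_contDiff_tendsto hp
  refine eLpNorm_le_of_ae_tendsto (f := fun k x => v k (x + z) - v k x)
    (fun k => ?_) ?_ (fun k => ((hv1 k).eLpNorm_translate_sub_le hp z).trans
      (mul_le_mul_right (hv3 k) _)) tendsto_const_nhds
  · have := (hv1 k).continuous
    exact (by fun_prop : Continuous fun x => v k (x + z) - v k x).aestronglyMeasurable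
  · filter_upwards [hv4, (measurePreserving_add_right volume z).quasiMeasurePreserving.ae hv4]
      with x h1 h2
    exact h2.sub h1

/-! ### The Sobolev inequality -/

theorem eLpNorm_le_add_mul_of_norm_le {α U V W : Type*} [MeasurableSpace α] {μ : Measure α}
    [NormedAddCommGroup U] [NormedAddCommGroup V] [NormedAddCommGroup W] {q : ℝ≥0∞} (hq : 1 ≤ q)
    {F : α → U} {f : α → V} {g : α → W} (hf : AEStronglyMeasurable f μ)
    (hg : AEStronglyMeasurable g μ) {b : ℝ} (hb : 0 ≤ b)
    (h : ∀ x, ‖F x‖ ≤ ‖f x‖ + b * ‖g x‖) :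
    eLpNorm F q μ ≤ eLpNorm f q μ + ENNReal.ofReal b * eLpNorm g q μ := by
  have h1 : eLpNorm F q μ ≤ eLpNorm ((fun x => ‖f x‖) + b • fun x => ‖g x‖) q μ :=
    eLpNorm_mono_real h
  refine h1.trans ((eLpNorm_add_le hf.norm (hg.norm.const_smul b) hq).trans ?_)
  rw [eLpNorm_const_smul, Real.enorm_of_nonneg hb, eLpNorm_norm, eLpNorm_norm]

/-- The Gagliardo–Nirenberg–Sobolev inequality for `C^1` functions in `W^{1,p}`. -/
theorem ContDiff.eLpNorm_le_eLpNorm_fderiv {n : ℕ} {p : ℝ} (hp : 1 ≤ p) (hpn : p < n)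
    {v : EuclideanSpace ℝ (Fin n) → ℝ} (hv : ContDiff ℝ 1 v)
    (hvp : eLpNorm v (ENNReal.ofReal p) volume ≠ ⊤) :
    eLpNorm v (ENNReal.ofReal (p * n / (n - p))) volume ≤
      SNormLESNormFDerivOfEqConst ℝ (volume : Measure (EuclideanSpace ℝ (Fin n)))
        (p.toNNReal : ℝ) * eLpNorm (fderiv ℝ v) (ENNReal.ofReal p) volume := by
  have hp0 : 0 < p := by linarith
  have hn0 : (0 : ℝ) < n := hp0.trans hpn
  -- The inequality for compactly supported functions is applied to χ(s x) v(x) with s → 0. The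
  -- cutoff adds at most s M |v| to the gradient, which vanishes in the limit because v is in L^p.
  let χ : ContDiffBump (0 : EuclideanSpace ℝ (Fin n)) := ⟨1, 2, one_pos, one_lt_two⟩
  have hχ : ContDiff ℝ 1 χ := χ.contDiff
  obtain ⟨M, hM⟩ := (χ.hasCompactSupport.fderiv ℝ).exists_bound_of_continuous
    (hχ.continuous_fderiv one_ne_zero)
  have hM0 : 0 ≤ M := (norm_nonneg _).trans (hM 0)
  let s : ℕ → ℝ := fun k => 1 / ((k : ℝ) + 1)
  have hs : ∀ k, 0 < s k := fun k => by positivity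
  have hs0 : Tendsto s atTop (𝓝 0) := tendsto_one_div_add_atTop_nhds_zero_nat
  let χs : ℕ → EuclideanSpace ℝ (Fin n) → ℝ := fun k x => χ (s k • x)
  have hχs : ∀ k, ContDiff ℝ 1 (χs k) := fun k => hχ.comp (contDiff_const_smul (s k))
  let w : ℕ → EuclideanSpace ℝ (Fin n) → ℝ := fun k x => χs k x * v x
  have hw : ∀ k, ContDiff ℝ 1 (w k) := fun k => (hχs k).mul hv
  have hwc : ∀ k, HasCompactSupport (w k) := fun k =>
    (χ.hasCompactSupport.comp_smul (hs k).ne').mul_right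
  have hdχ : ∀ k x, ‖fderiv ℝ (χs k) x‖ ≤ s k * M := fun k x => by
    have h1 : HasFDerivAt (χs k) ((fderiv ℝ χ (s k • x)).comp
        (s k • ContinuousLinearMap.id ℝ (EuclideanSpace ℝ (Fin n)))) x :=
      ((hχ.differentiable one_ne_zero _).hasFDerivAt).comp x
        ((hasFDerivAt_id x).const_smul (s k))
    rw [h1.fderiv, ContinuousLinearMap.comp_smul, ContinuousLinearMap.comp_id, norm_smul,
      Real.norm_of_nonneg (hs k).le]
    exact mul_le_mul_of_nonneg_left (hM _) (hs k).le
  have hdw : ∀ k x, ‖fderiv ℝ (w k) x‖ ≤ ‖fderiv ℝ v x‖ + s k * M * ‖v x‖ := fun k x => by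
    have h1 : fderiv ℝ (w k) x = χs k x • fderiv ℝ v x + v x • fderiv ℝ (χs k) x :=
      fderiv_mul ((hχs k).differentiable one_ne_zero x) (hv.differentiable one_ne_zero x)
    rw [h1]
    refine (norm_add_le _ _).trans (add_le_add ?_ ?_)
    · rw [norm_smul, Real.norm_of_nonneg χ.nonneg]
      exact mul_le_of_le_one_left (norm_nonneg _) χ.le_one
    · rw [norm_smul, mul_comm]
      exact mul_le_mul_of_nonneg_right (hdχ k x) (norm_nonneg _)
  have hdv : Continuous (fderiv ℝ v) := hv.continuous_fderiv one_ne_zero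
  have hbound : ∀ k, eLpNorm (w k) (ENNReal.ofReal (p * n / (n - p))) volume ≤
      SNormLESNormFDerivOfEqConst ℝ (volume : Measure (EuclideanSpace ℝ (Fin n)))
        (p.toNNReal : ℝ) * (eLpNorm (fderiv ℝ v) (ENNReal.ofReal p) volume +
          ENNReal.ofReal (s k * M) * eLpNorm v (ENNReal.ofReal p) volume) := fun k => by
    refine (eLpNorm_le_eLpNorm_fderiv_of_eq volume (hw k) (hwc k) (p := p.toNNReal)
      (p' := (p * n / (n - p)).toNNReal) (by simpa using hp) (by simpa using hn0) ?_).trans ?_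
    · have hnp : 0 < (n : ℝ) - p := by linarith
      rw [Real.coe_toNNReal _ (by positivity), NNReal.coe_inv, Real.coe_toNNReal _ hp0.le,
        finrank_euclideanSpace_fin]
      field_simp
    · gcongr
      exact eLpNorm_le_add_mul_of_norm_le (by simpa using hp) hdv.aestronglyMeasurable
        hv.continuous.aestronglyMeasurable (mul_nonneg (hs k).le hM0) (hdw k)
  refine eLpNorm_le_of_ae_tendsto (f := w) (fun k => (hw k).continuous.aestronglyMeasurable)
    (Eventually.of_forall fun x => ?_) hbound ?_
  · have h1 : Tendsto (fun k => χs k x) atTop (𝓝 (χ 0)) := by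
      refine (χ.continuous.tendsto 0).comp ?_
      simpa using hs0.smul_const x
    have h2 : χ (0 : EuclideanSpace ℝ (Fin n)) = 1 := χ.one_of_mem_closedBall (by simp [χ])
    rw [h2] at h1
    simpa using h1.mul_const (v x)
  · refine ENNReal.Tendsto.const_mul ?_ (Or.inr ENNReal.coe_ne_top)
    have h1 : Tendsto (fun k => ENNReal.ofReal (s k * M)) atTop (𝓝 0) := by
      simpa using ENNReal.tendsto_ofReal (hs0.mul_const M)
    simpa using (ENNReal.Tendsto.mul_const h1 (Or.inr hvp)).const_add
      (eLpNorm (fderiv ℝ v) (ENNReal.ofReal p) volume)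

/-- The Gagliardo–Nirenberg–Sobolev inequality in `W^{1,p}`. -/
theorem IsWeakGradient.eLpNorm_le_eLpNorm_grad {n : ℕ} {p : ℝ} (hp : 1 ≤ p) (hpn : p < n)
    {u : EuclideanSpace ℝ (Fin n) → ℝ}
    {g : EuclideanSpace ℝ (Fin n) → EuclideanSpace ℝ (Fin n)} (h : IsWeakGradient u g)
    (hu : eLpNorm u (ENNReal.ofReal p) volume ≠ ⊤) :
    eLpNorm u (ENNReal.ofReal (p * n / (n - p))) volume ≤
      SNormLESNormFDerivOfEqConst ℝ (volume : Measure (EuclideanSpace ℝ (Fin n)))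
        (p.toNNReal : ℝ) * eLpNorm g (ENNReal.ofReal p) volume := by
  obtain ⟨v, hv1, hv2, hv3, hv4⟩ := h.exists_contDiff_tendsto hp
  exact eLpNorm_le_of_ae_tendsto (fun k => (hv1 k).continuous.aestronglyMeasurable) hv4
    (fun k => ((hv1 k).eLpNorm_le_eLpNorm_fderiv hp hpn
      (ne_top_of_le_ne_top hu (hv2 k))).trans (mul_le_mul_right (hv3 k) _)) tendsto_const_nhds

/-! ### Interpolation, for norms and for compactness -/

/-- Interpolation of `L^r` between `L^s` and `L^q`. -/
theorem eLpNorm_le_rpow_mul_rpow {X V : Type*} [MeasurableSpace X] {μ : Measure X}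
    [NormedAddCommGroup V] {s r q : ℝ} (hs : 0 < s) (hsr : s ≤ r) (hrq : r ≤ q) (hsq : s < q)
    {f : X → V} (hf : AEStronglyMeasurable f μ) :
    eLpNorm f (ENNReal.ofReal r) μ ≤
      eLpNorm f (ENNReal.ofReal s) μ ^ (s * (q - r) / ((q - s) * r)) *
        eLpNorm f (ENNReal.ofReal q) μ ^ (q * (r - s) / ((q - s) * r)) := by
  have hr : 0 < r := hs.trans_le hsr
  have hq : 0 < q := hr.trans_le hrq
  have hqs : 0 < q - s := sub_pos.2 hsq
  -- Hölder's inequality with the weights that make r a convex combination of s and q.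
  have h1 : ∫⁻ x, ‖f x‖ₑ ^ r ∂μ ≤ (∫⁻ x, ‖f x‖ₑ ^ s ∂μ) ^ ((q - r) / (q - s)) *
      (∫⁻ x, ‖f x‖ₑ ^ q ∂μ) ^ ((r - s) / (q - s)) := by
    refine le_trans (lintegral_mono fun x => ?_) (ENNReal.lintegral_mul_norm_pow_le
      (hf.enorm.pow_const s) (hf.enorm.pow_const q)
      (div_nonneg (by linarith) hqs.le) (div_nonneg (by linarith) hqs.le)
      (by field_simp; ring))
    rw [← ENNReal.rpow_mul, ← ENNReal.rpow_mul, ← ENNReal.rpow_add_of_nonneg]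
    · refine le_of_eq ?_
      congr 1
      field_simp
      ring
    · exact mul_nonneg hs.le (div_nonneg (by linarith) hqs.le)
    · exact mul_nonneg hq.le (div_nonneg (by linarith) hqs.le)
  simp only [lintegral_enorm_rpow_eq_eLpNorm_rpow μ hr, lintegral_enorm_rpow_eq_eLpNorm_rpow μ hs,
    lintegral_enorm_rpow_eq_eLpNorm_rpow μ hq] at h1
  have h2 := ENNReal.rpow_le_rpow h1 (inv_nonneg.2 hr.le)
  rw [ENNReal.rpow_rpow_inv hr.ne', ENNReal.mul_rpow_of_nonneg _ _ (inv_nonneg.2 hr.le)] at h2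
  simp only [← ENNReal.rpow_mul] at h2
  refine h2.trans_eq ?_
  congr 2 <;> field_simp

/-- An operator controlled by interpolation between a compact operator and the norm is compact. -/
theorem isCompactOperator_of_norm_le_rpow_mul_rpow {E F G : Type*} [NormedAddCommGroup E]
    [NormedSpace ℝ E] [NormedAddCommGroup F] [NormedSpace ℝ F] [NormedAddCommGroup G]
    [NormedSpace ℝ G] [CompleteSpace G] {T : E →L[ℝ] F} (hT : IsCompactOperator T)
    {S : E →L[ℝ] G} {C α β : ℝ} (hC : 0 ≤ C) (hα : 0 < α) (hβ : 0 ≤ β)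
    (h : ∀ u, ‖S u‖ ≤ C * ‖T u‖ ^ α * ‖u‖ ^ β) : IsCompactOperator S := by
  refine (isCompactOperator_iff_isCompact_closure_image_closedBall
    (S : E →ₗ[ℝ] G) one_pos).2 ?_
  refine isCompact_iff_totallyBounded_isComplete.2
    ⟨TotallyBounded.closure ?_, isClosed_closure.isComplete⟩
  have hTb : TotallyBounded (T '' Metric.closedBall 0 1) :=
    (((isCompactOperator_iff_isCompact_closure_image_closedBall (T : E →ₗ[ℝ] F) one_pos).1
      hT).totallyBounded).subset subset_closure
  rw [Metric.totallyBounded_iff]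
  intro ε hε
  -- Points of the unit ball differ by at most 2 in norm, whence 2^β; such δ exists because α > 0.
  -- Preimages of a δ-net for T are then mapped by S to an ε-net.
  obtain ⟨δ, hδ, hδε⟩ : ∃ δ > 0, C * δ ^ α * 2 ^ β < ε := by
    have ht : Tendsto (fun δ : ℝ => C * δ ^ α * 2 ^ β) (𝓝[>] 0) (𝓝 (C * 0 ^ α * 2 ^ β)) :=
      (((Real.continuousAt_rpow_const 0 α (Or.inr hα.le)).tendsto.mono_left
        nhdsWithin_le_nhds).const_mul C).mul_const _
    rw [Real.zero_rpow hα.ne', mul_zero, zero_mul] at ht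
    obtain ⟨δ, h1, h2⟩ := ((ht.eventually_lt_const hε).and self_mem_nhdsWithin).exists
    exact ⟨δ, h2, h1⟩
  obtain ⟨t, hts, htf, htc⟩ := Set.exists_subset_image_finite_and.1
    (Metric.finite_approx_of_totallyBounded hTb δ hδ)
  refine ⟨S '' t, htf.image _, ?_⟩
  rintro _ ⟨u, hu, rfl⟩
  have hTu := htc (mem_image_of_mem T hu)
  simp only [mem_iUnion, exists_prop, exists_mem_image] at hTu ⊢
  obtain ⟨v, hv, huv⟩ := hTu
  refine ⟨v, hv, ?_⟩
  rw [Metric.mem_ball, dist_eq_norm] at huv ⊢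
  rw [← map_sub] at huv
  have hn : ‖u - v‖ ≤ 2 := by
    have h1 : ‖u‖ ≤ 1 := by simpa using hu
    have h2 : ‖v‖ ≤ 1 := by simpa using hts hv
    linarith [norm_sub_le u v]
  change ‖S u - S v‖ < ε
  rw [← map_sub]
  refine (h (u - v)).trans_lt (lt_of_le_of_lt ?_ hδε)
  gcongr

/-! ### Continuous embeddings of E and their dense images -/

namespace WeightedSobolev

variable {n : ℕ} {p : ℝ} {hp : 1 ≤ p} {a : C(EuclideanSpace ℝ (Fin n), ℝ)} {ha : ∀ x, 1 ≤ a x}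

theorem eLpNorm_grad_le (u : WeightedSobolev hp a ha) :
    eLpNorm u.grad (ENNReal.ofReal p) volume ≤ ENNReal.ofReal ‖u‖ := by
  have : Fact (1 ≤ ENNReal.ofReal p) := ⟨by simpa using hp⟩
  rw [ofReal_norm]
  exact eLpNorm_mono fun x => WithLp.norm_fst_le _ (u.pair x)

theorem eLpNorm_weight_le (u : WeightedSobolev hp a ha) :
    eLpNorm (fun x => a x ^ (1 / p) * u.toFun x) (ENNReal.ofReal p) volume ≤
      ENNReal.ofReal ‖u‖ := by
  have : Fact (1 ≤ ENNReal.ofReal p) := ⟨by simpa using hp⟩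
  rw [ofReal_norm]
  exact eLpNorm_mono fun x => WithLp.norm_snd_le _ (u.pair x)

theorem stronglyMeasurable_toFun (u : WeightedSobolev hp a ha) : StronglyMeasurable u.toFun :=
  Lp.stronglyMeasurable u.toW1p.1

/-- Hölder's inequality for the weight. -/
theorem eLpNorm_two_restrict_le (hp2 : 2 < p) (u : WeightedSobolev hp a ha)
    (S : Set (EuclideanSpace ℝ (Fin n))) :
    eLpNorm u.toFun 2 (volume.restrict S) ≤
      eLpNorm (fun x => a x ^ (-(1 / p))) (ENNReal.ofReal (2 * p / (p - 2)))
        (volume.restrict S) * ENNReal.ofReal ‖u‖ := by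
  have hp0 : 0 < p := by linarith
  have hp2' : 0 < p - 2 := by linarith
  -- The exponents satisfy (p - 2)/(2p) + 1/p = 1/2.
  have : ENNReal.HolderTriple (ENNReal.ofReal (2 * p / (p - 2))) (ENNReal.ofReal p) 2 := ⟨by
    rw [← ENNReal.ofReal_inv_of_pos (by positivity), ← ENNReal.ofReal_inv_of_pos hp0,
      ← ENNReal.ofReal_add (by positivity) (by positivity), ← ENNReal.ofReal_ofNat 2,
      ← ENNReal.ofReal_inv_of_pos (by norm_num)]
    congr 1
    field_simp
    ring⟩
  have h1 := eLpNorm_smul_le_mul_eLpNorm (r := 2) (p := ENNReal.ofReal (2 * p / (p - 2)))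
    (q := ENNReal.ofReal p) (μ := volume.restrict S)
    (f := fun x => a x ^ (1 / p) * u.toFun x) (φ := fun x => a x ^ (-(1 / p)))
    (memLp_weight u).1.restrict
    (continuous_rpow_of_one_le a ha _).aestronglyMeasurable
  have h2 : ((fun x => a x ^ (-(1 / p))) • fun x => a x ^ (1 / p) * u.toFun x) = u.toFun := by
    ext x
    simp only [Pi.smul_apply', smul_eq_mul]
    rw [← mul_assoc, ← Real.rpow_add (zero_lt_one.trans_le (ha x)), neg_add_cancel,
      Real.rpow_zero, one_mul]
  rw [h2] at h1
  exact h1.trans (mul_le_mul_right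
    ((eLpNorm_mono_measure _ Measure.restrict_le_self).trans u.eLpNorm_weight_le) _)

theorem eLpNorm_two_le (hp2 : 2 < p) (u : WeightedSobolev hp a ha) :
    eLpNorm u.toFun 2 volume ≤
      eLpNorm (fun x => a x ^ (-(1 / p))) (ENNReal.ofReal (2 * p / (p - 2))) volume *
        ENNReal.ofReal ‖u‖ := by
  simpa using u.eLpNorm_two_restrict_le hp2 univ

theorem eLpNorm_sobolev_le (hpn : p < n) (u : WeightedSobolev hp a ha) :
    eLpNorm u.toFun (ENNReal.ofReal (p * n / (n - p))) volume ≤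
      SNormLESNormFDerivOfEqConst ℝ (volume : Measure (EuclideanSpace ℝ (Fin n)))
        (p.toNNReal : ℝ) * ENNReal.ofReal ‖u‖ :=
  (u.isWeakGradient.eLpNorm_le_eLpNorm_grad hp hpn u.memLp_toFun.eLpNorm_ne_top).trans
    (mul_le_mul_right u.eLpNorm_grad_le _)

theorem memLp_of_eLpNorm_le {u : WeightedSobolev hp a ha} {q C : ℝ≥0∞} (hC : C ≠ ⊤)
    (h : eLpNorm u.toFun q volume ≤ C * ENNReal.ofReal ‖u‖) : MemLp u.toFun q volume :=
  ⟨u.stronglyMeasurable_toFun.aestronglyMeasurable,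
    h.trans_lt (ENNReal.mul_lt_top hC.lt_top ENNReal.ofReal_lt_top)⟩

/-- The inclusion of `E` in `L^q` given by a bound for the norms. -/
noncomputable def inclusionLp (q : ℝ≥0∞) [Fact (1 ≤ q)] (C : ℝ≥0∞) (hC : C ≠ ⊤)
    (h : ∀ u : WeightedSobolev hp a ha, eLpNorm u.toFun q volume ≤ C * ENNReal.ofReal ‖u‖) :
    WeightedSobolev hp a ha →L[ℝ] Lp ℝ q (volume : Measure (EuclideanSpace ℝ (Fin n))) :=
  have hm : ∀ u : WeightedSobolev hp a ha, MemLp u.toFun q volume := fun u =>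
    memLp_of_eLpNorm_le hC (h u)
  LinearMap.mkContinuous
    { toFun := fun u => (hm u).toLp
      map_add' := fun u v => by
        rw [← MemLp.toLp_add]
        exact MemLp.toLp_congr _ _ (toFun_add u v)
      map_smul' := fun c u => by
        rw [RingHom.id_apply, ← MemLp.toLp_const_smul]
        exact MemLp.toLp_congr _ _ (toFun_smul c u) }
    C.toReal fun u => by
      refine (Lp.norm_toLp _ (hm u)).trans_le ?_
      refine (ENNReal.toReal_mono (ENNReal.mul_ne_top hC ENNReal.ofReal_ne_top) (h u)).trans_eq ?_
      rw [ENNReal.toReal_mul, ENNReal.toReal_ofReal (norm_nonneg _)]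

section inclusionLp

variable {q : ℝ≥0∞} [Fact (1 ≤ q)] {C : ℝ≥0∞} {hC : C ≠ ⊤}
  {h : ∀ u : WeightedSobolev hp a ha, eLpNorm u.toFun q volume ≤ C * ENNReal.ofReal ‖u‖}

theorem coeFn_inclusionLp (u : WeightedSobolev hp a ha) :
    inclusionLp q C hC h u =ᵐ[volume] u.toFun :=
  (memLp_of_eLpNorm_le hC (h u)).coeFn_toLp

theorem norm_inclusionLp (u : WeightedSobolev hp a ha) :
    ‖inclusionLp q C hC h u‖ = (eLpNorm u.toFun q volume).toReal :=
  Lp.norm_toLp _ (memLp_of_eLpNorm_le hC (h u))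

theorem norm_inclusionLp_le (u : WeightedSobolev hp a ha) :
    ‖inclusionLp q C hC h u‖ ≤ C.toReal * ‖u‖ := by
  rw [norm_inclusionLp]
  refine (ENNReal.toReal_mono (ENNReal.mul_ne_top hC ENNReal.ofReal_ne_top) (h u)).trans_eq ?_
  rw [ENNReal.toReal_mul, ENNReal.toReal_ofReal (norm_nonneg _)]

end inclusionLp

end WeightedSobolev

/-- A test function has its gradient as weak gradient. -/
theorem ContDiff.isWeakGradient_gradient {n : ℕ} {f : EuclideanSpace ℝ (Fin n) → ℝ}
    (hf : ContDiff ℝ 1 f) : IsWeakGradient f (gradient f) := by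
  have hdf : Continuous (fderiv ℝ f) := hf.continuous_fderiv one_ne_zero
  have hg : Continuous (gradient f) :=
    (InnerProductSpace.toDual ℝ (EuclideanSpace ℝ (Fin n))).symm.continuous.comp hdf
  refine ⟨hf.continuous.locallyIntegrable, hg.locallyIntegrable, fun φ hφ hc i => ?_⟩
  have hφ1 : ContDiff ℝ 1 φ := hφ.of_le (by exact_mod_cast le_top)
  have hdφ : Continuous fun x => fderiv ℝ φ x (EuclideanSpace.single i 1) :=
    (hφ1.continuous_fderiv one_ne_zero).clm_apply continuous_const
  have hcoord : ∀ x, gradient f x i = fderiv ℝ f x (EuclideanSpace.single i 1) := fun x => by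
    have h1 : Inner.inner ℝ (gradient f x) (EuclideanSpace.single i (1 : ℝ)) =
        fderiv ℝ f x (EuclideanSpace.single i 1) := InnerProductSpace.toDual_symm_apply
    rw [← h1, EuclideanSpace.inner_single_right]
    simp
  simp only [hcoord]
  refine integral_mul_fderiv_eq_neg_fderiv_mul_of_integrable ?_ ?_ ?_
    (fun x _ => hf.differentiable one_ne_zero x) (fun x _ => hφ1.differentiable one_ne_zero x)
  · exact ((hdf.clm_apply continuous_const).mul hφ.continuous).integrable_of_hasCompactSupport
      hc.mul_left
  · exact (hf.continuous.mul hdφ).integrable_of_hasCompactSupport (hc.fderiv_apply ℝ _).mul_left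
  · exact (hf.continuous.mul hφ.continuous).integrable_of_hasCompactSupport hc.mul_left

namespace WeightedSobolev

variable {n : ℕ} {p : ℝ} {hp : 1 ≤ p} {a : C(EuclideanSpace ℝ (Fin n), ℝ)} {ha : ∀ x, 1 ≤ a x}

/-- However fast a grows, it is bounded on the support of a test function, so the weighted integral
is finite. -/
theorem exists_toFun_ae_eq {f : EuclideanSpace ℝ (Fin n) → ℝ} (hf : ContDiff ℝ ∞ f)
    (hc : HasCompactSupport f) : ∃ u : WeightedSobolev hp a ha, u.toFun =ᵐ[volume] f := by
  have hf1 : ContDiff ℝ 1 f := hf.of_le (by exact_mod_cast le_top)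
  have hg : Continuous (gradient f) :=
    (InnerProductSpace.toDual ℝ (EuclideanSpace ℝ (Fin n))).symm.continuous.comp
      (hf1.continuous_fderiv one_ne_zero)
  have hgc : HasCompactSupport (gradient f) :=
    (hc.fderiv ℝ).comp_left (g := (InnerProductSpace.toDual ℝ (EuclideanSpace ℝ (Fin n))).symm)
      (map_zero _)
  have hp0 : 0 < p := by linarith
  refine ⟨mk' f (gradient f) (hf.continuous.memLp_of_hasCompactSupport hc)
    (hg.memLp_of_hasCompactSupport hgc) hf1.isWeakGradient_gradient ?_, toFun_mk' _ _ _ _⟩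
  refine (a.continuous.mul (hf.continuous.abs.rpow_const fun x =>
    Or.inr hp0.le)).integrable_of_hasCompactSupport (HasCompactSupport.mul_left ?_)
  exact hc.comp_left (g := fun t => |t| ^ p) (by simp [hp0.ne'])

theorem denseRange_inclusionLp {q : ℝ≥0∞} [Fact (1 ≤ q)] (hq : q ≠ ⊤) {C : ℝ≥0∞} {hC : C ≠ ⊤}
    {h : ∀ u : WeightedSobolev hp a ha, eLpNorm u.toFun q volume ≤ C * ENNReal.ofReal ‖u‖} :
    DenseRange (inclusionLp q C hC h) := by
  refine (Lp.dense_hasCompactSupport_contDiff hq).mono ?_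
  rintro f ⟨g, hfg, hgc, hg⟩
  obtain ⟨u, hu⟩ := exists_toFun_ae_eq (hp := hp) (ha := ha) hg hgc
  exact ⟨u, Lp.ext ((coeFn_inclusionLp u).trans (hu.trans hfg.symm))⟩

end WeightedSobolev

/-! ### Compactness of the inclusion in L² -/

/-- Replacing `u(x)` by its mean value over a ball of radius `ρ` around a point `c(x)` which is
closer than `ρ` to `x` costs at most `2^n 2ρ ‖∇u‖_p` in `L^p`. -/
theorem IsWeakGradient.eLpNorm_sub_average_ball_le {n : ℕ} {p : ℝ} (hp : 1 ≤ p)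
    {u : EuclideanSpace ℝ (Fin n) → ℝ}
    {g : EuclideanSpace ℝ (Fin n) → EuclideanSpace ℝ (Fin n)} (h : IsWeakGradient u g)
    (hu : StronglyMeasurable u) {B : Set (EuclideanSpace ℝ (Fin n))} (hB : MeasurableSet B)
    {c : EuclideanSpace ℝ (Fin n) → EuclideanSpace ℝ (Fin n)} {ρ : ℝ} (hρ : 0 < ρ)
    (hc : ∀ x ∈ B, dist (c x) x < ρ) :
    eLpNorm (fun x => u x - ⨍ y in Metric.ball (c x) ρ, u y) (ENNReal.ofReal p)
      (volume.restrict B) ≤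
      2 ^ n * ENNReal.ofReal (2 * ρ) * eLpNorm g (ENNReal.ofReal p) volume := by
  -- For x in B the ball around c(x), translated by -x, lies in D. Hence the mean of |u(y) - u(x)|
  -- over it is at most |D| / |ball| = 2^n times the mean of |u(x + z) - u(x)| over z in D, where
  -- |z| < 2ρ.
  set D := Metric.ball (0 : EuclideanSpace ℝ (Fin n)) (2 * ρ)
  have hp0 : 0 < p := by linarith
  have hD0 : volume D ≠ 0 := (Metric.measure_ball_pos volume _ (by positivity)).ne'
  have hDt : volume D ≠ ⊤ := measure_ball_lt_top.ne
  have : IsProbabilityMeasure (ProbabilityTheory.cond volume D) :=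
    ProbabilityTheory.cond_isProbabilityMeasure_of_finite hD0 hDt
  have hvol : ∀ z : EuclideanSpace ℝ (Fin n),
      (volume (Metric.ball z ρ))⁻¹ = 2 ^ n * (volume D)⁻¹ := fun z => by
    have h1 : volume D = 2 ^ n * volume (Metric.ball z ρ) := by
      rw [Measure.addHaar_ball_of_pos volume z hρ,
        Measure.addHaar_ball_of_pos volume _ (by positivity : 0 < 2 * ρ),
        finrank_euclideanSpace_fin, mul_pow, ENNReal.ofReal_mul (by positivity),
        ENNReal.ofReal_pow zero_le_two, ENNReal.ofReal_ofNat, mul_assoc]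
    rw [h1, ENNReal.mul_inv (Or.inl (by simp)) (Or.inl (by simp)), ← mul_assoc,
      ENNReal.mul_inv_cancel (by simp) (by simp), one_mul]
  have hm : Measurable fun z : EuclideanSpace ℝ (Fin n) × EuclideanSpace ℝ (Fin n) =>
      ‖u (z.1 + z.2) - u z.1‖ₑ :=
    ((hu.measurable.comp (measurable_fst.add measurable_snd)).sub
      (hu.measurable.comp measurable_fst)).enorm
  rw [← eLpNorm_indicator_eq_eLpNorm_restrict hB]
  refine eLpNorm_le_of_enorm_le_lintegral (ν := ProbabilityTheory.cond volume D) hp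
    (Φ := fun x z => 2 ^ n * ‖u (x + z) - u x‖ₑ) (hm.const_mul _) ?_ fun x => ?_
  · filter_upwards [ProbabilityTheory.ae_cond_mem (μ := volume) measurableSet_ball] with z hz
    have hmz : Measurable fun x => ‖u (x + z) - u x‖ₑ :=
      ((hu.measurable.comp (measurable_add_const z)).sub hu.measurable).enorm
    simp only [ENNReal.mul_rpow_of_nonneg _ _ hp0.le]
    rw [lintegral_const_mul _ (hmz.pow_const p),
      lintegral_enorm_rpow_eq_eLpNorm_rpow volume hp0 fun x => u (x + z) - u x,
      ← ENNReal.mul_rpow_of_nonneg _ _ hp0.le, ← ENNReal.mul_rpow_of_nonneg _ _ hp0.le,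
      ← ENNReal.mul_rpow_of_nonneg _ _ hp0.le, mul_assoc]
    refine ENNReal.rpow_le_rpow (mul_le_mul_right ((h.eLpNorm_translate_sub_le hp z).trans ?_) _)
      hp0.le
    refine mul_le_mul_left ?_ _
    rw [← ofReal_norm]
    exact ENNReal.ofReal_le_ofReal (by simpa using (Metric.mem_ball.1 hz).le)
  · by_cases hx : x ∈ B
    swap
    · simp [hx]
    have hball0 : volume (Metric.ball (c x) ρ) ≠ 0 := (Metric.measure_ball_pos volume _ hρ).ne'
    have hballt : volume (Metric.ball (c x) ρ) ≠ ⊤ := measure_ball_lt_top.ne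
    have hint : IntegrableOn u (Metric.ball (c x) ρ) :=
      (h.1.integrableOn_isCompact (isCompact_closedBall _ _)).mono_set Metric.ball_subset_closedBall
    have hconst : IntegrableOn (fun _ => u x) (Metric.ball (c x) ρ) :=
      integrableOn_const hballt
    have hsub : u x - ⨍ y in Metric.ball (c x) ρ, u y =
        -⨍ y in Metric.ball (c x) ρ, (u y - u x) := by
      rw [setAverage_eq, setAverage_eq, integral_sub hint hconst, setIntegral_const, smul_sub,
        smul_smul, inv_mul_cancel₀ (by
          rw [measureReal_def]
          exact (ENNReal.toReal_pos hball0 hballt).ne'), one_smul, neg_sub]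
    have hmx : Measurable fun z => ‖u (x + z) - u x‖ₑ :=
      ((hu.measurable.comp (measurable_const_add x)).sub_const _).enorm
    rw [indicator_of_mem hx, hsub, enorm_neg, setAverage_eq, enorm_smul, enorm_inv (by
      rw [measureReal_def]
      exact (ENNReal.toReal_pos hball0 hballt).ne'), measureReal_def, Real.enorm_of_nonneg
        ENNReal.toReal_nonneg, ENNReal.ofReal_toReal hballt, hvol,
      lintegral_const_mul _ hmx, mul_assoc,
      ProbabilityTheory.cond, lintegral_smul_measure, smul_eq_mul]
    gcongr
    refine (enorm_integral_le_lintegral_enorm _).trans ?_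
    rw [← lintegral_indicator measurableSet_ball, ← lintegral_indicator measurableSet_ball,
      ← lintegral_add_left_eq_self
        ((Metric.ball (c x) ρ).indicator fun y => ‖u y - u x‖ₑ) x]
    refine lintegral_mono fun z => ?_
    by_cases hz : x + z ∈ Metric.ball (c x) ρ
    · have hzD : z ∈ D := by
        have h1 := hc x hx
        have h2 : dist (x + z) x < ρ + ρ := by
          refine (dist_triangle _ (c x) _).trans_lt (add_lt_add (Metric.mem_ball.1 hz) h1)
        simp only [dist_self_add_left] at h2
        simpa [D, two_mul] using h2
      rw [indicator_of_mem hz, indicator_of_mem hzD]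
    · rw [indicator_of_notMem hz]
      exact zero_le

/-- Finitely many centres make the averaging operator finite-rank; a nearest-point choice makes the
dependence on x measurable. -/
theorem exists_simpleFunc_dist_lt {X : Type*} [MetricSpace X] [MeasurableSpace X]
    [OpensMeasurableSpace X] [Nonempty X] {B : Set X} (hB : TotallyBounded B) {ρ : ℝ} (hρ : 0 < ρ) :
    ∃ c : SimpleFunc X X, ∀ x ∈ B, dist (c x) x < ρ := by
  obtain ⟨t, htf, ht⟩ := Metric.totallyBounded_iff.1 hB ρ hρ
  obtain ⟨N, e, he⟩ := htf.fin_embedding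
  classical
  -- `nearestPt e' N` also considers the index N, where `e'` takes the arbitrary value; an extra
  -- candidate can only bring the nearest point closer.
  let e' : ℕ → X := fun k => if hk : k < N then e ⟨k, hk⟩ else Classical.arbitrary X
  refine ⟨SimpleFunc.nearestPt e' N, fun x hx => ?_⟩
  obtain ⟨y, hy, hxy⟩ := mem_iUnion₂.1 (ht hx)
  rw [← he] at hy
  obtain ⟨k, rfl⟩ := hy
  have h1 : e' k = e k := by simp [e']
  have h2 := SimpleFunc.edist_nearestPt_le e' x (k := k) (N := N) k.2.le
  rw [h1, edist_dist, edist_dist, ENNReal.ofReal_le_ofReal_iff dist_nonneg] at h2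
  exact h2.trans_lt (by rwa [dist_comm])

/-- The `L^q` norm of a function in `L^q` is small outside a bounded set. -/
theorem MeasureTheory.MemLp.exists_isBounded_eLpNorm_compl_le {X V : Type*}
    [PseudoMetricSpace X] [Nonempty X] [MeasurableSpace X] [OpensMeasurableSpace X]
    {μ : Measure X} [NormedAddCommGroup V] {q : ℝ≥0∞} {f : X → V} (hf : MemLp f q μ)
    (hq : q ≠ ⊤) {ε : ℝ≥0∞} (hε : 0 < ε) :
    ∃ B : Set X, MeasurableSet B ∧ Bornology.IsBounded B ∧
      eLpNorm f q (μ.restrict Bᶜ) ≤ ε := by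
  by_cases hq0 : q = 0
  · exact ⟨∅, MeasurableSet.empty, Bornology.isBounded_empty, by simp [hq0]⟩
  have hq' : 0 < q.toReal := ENNReal.toReal_pos hq0 hq
  have hfin := lintegral_rpow_enorm_lt_top_of_eLpNorm_lt_top hq0 hq hf.2
  let x₀ : X := Classical.arbitrary X
  -- The measure |f|^q dμ is finite, so it is continuous from above along complements of growing
  -- balls, whose intersection is empty.
  let ν := μ.withDensity fun x => ‖f x‖ₑ ^ q.toReal
  have hν : IsFiniteMeasure ν := isFiniteMeasure_withDensity hfin.ne
  have ht : Tendsto (fun k : ℕ => ν (Metric.closedBall x₀ k)ᶜ) atTop (𝓝 (ν (⋂ k : ℕ,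
      (Metric.closedBall x₀ (k : ℝ))ᶜ))) :=
    tendsto_measure_iInter_atTop
      (fun k => Metric.isClosed_closedBall.measurableSet.compl.nullMeasurableSet)
      (fun i j hij => compl_subset_compl.2
        (Metric.closedBall_subset_closedBall (by exact_mod_cast hij)))
      ⟨0, measure_ne_top _ _⟩
  rw [← compl_iUnion, Metric.iUnion_closedBall_nat, compl_univ, measure_empty] at ht
  obtain ⟨k, hk⟩ := (ht.eventually_lt_const (ENNReal.rpow_pos_of_nonneg hε hq'.le)).exists
  refine ⟨Metric.closedBall x₀ k, Metric.isClosed_closedBall.measurableSet,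
    Metric.isBounded_closedBall, ?_⟩
  rw [withDensity_apply _ Metric.isClosed_closedBall.measurableSet.compl] at hk
  rw [eLpNorm_eq_lintegral_rpow_enorm_toReal hq0 hq, one_div, ENNReal.rpow_inv_le_iff hq']
  exact hk.le

namespace WeightedSobolev

variable {n : ℕ} {p : ℝ} {hp : 1 ≤ p} {a : C(EuclideanSpace ℝ (Fin n), ℝ)} {ha : ∀ x, 1 ≤ a x}

/-- Finite-rank approximation in `L^2` by mean values over balls. -/
theorem exists_isCompactOperator_eq_indicator_average
    (ι : WeightedSobolev hp a ha →L[ℝ] Lp ℝ 2 (volume : Measure (EuclideanSpace ℝ (Fin n))))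
    (hι : ∀ u, ι u =ᵐ[volume] u.toFun) {B : Set (EuclideanSpace ℝ (Fin n))}
    (hB : MeasurableSet B) (hBt : volume B ≠ ⊤)
    (c : SimpleFunc (EuclideanSpace ℝ (Fin n)) (EuclideanSpace ℝ (Fin n))) (ρ : ℝ) :
    ∃ P : WeightedSobolev hp a ha →L[ℝ] Lp ℝ 2 (volume : Measure (EuclideanSpace ℝ (Fin n))),
      IsCompactOperator P ∧ ∀ u, P u =ᵐ[volume]
        B.indicator fun x => ⨍ y in Metric.ball (c x) ρ, u.toFun y := by
  have hs : ∀ y, MeasurableSet (B ∩ c ⁻¹' {y}) := fun y => hB.inter (c.measurableSet_fiber y)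
  have hst : ∀ y, volume (B ∩ c ⁻¹' {y}) ≠ ⊤ := fun y => measure_ne_top_of_subset inter_subset_left hBt
  -- The mean over a ball is the L² inner product with a normalised indicator, hence a bounded
  -- functional.
  let ℓ : EuclideanSpace ℝ (Fin n) → WeightedSobolev hp a ha →L[ℝ] ℝ := fun y =>
    (volume.real (Metric.ball y ρ))⁻¹ • (innerSL ℝ (indicatorConstLp 2
      (measurableSet_ball (x := y) (ε := ρ)) measure_ball_lt_top.ne (1 : ℝ)) ∘L ι)
  have hℓ : ∀ y u, ℓ y u = ⨍ z in Metric.ball y ρ, u.toFun z := fun y u => by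
    have h1 : ℓ y u = (volume.real (Metric.ball y ρ))⁻¹ • inner ℝ (indicatorConstLp 2
      (measurableSet_ball (x := y) (ε := ρ)) measure_ball_lt_top.ne (1 : ℝ)) (ι u) := rfl
    rw [h1, L2.inner_indicatorConstLp_one, setAverage_eq]
    congr 1
    exact integral_congr_ae (ae_restrict_of_ae (hι u))
  let P : WeightedSobolev hp a ha →L[ℝ]
      Lp ℝ 2 (volume : Measure (EuclideanSpace ℝ (Fin n))) :=
    ∑ y ∈ c.range, (ℓ y).smulRight (indicatorConstLp 2 (hs y) (hst y) (1 : ℝ))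
  refine ⟨P, ?_, fun u => ?_⟩
  · refine (compactOperator (RingHom.id ℝ) (WeightedSobolev hp a ha)
      (Lp ℝ 2 (volume : Measure (EuclideanSpace ℝ (Fin n))))).sum_mem fun y _ => ?_
    exact (isCompactOperator_of_locallyCompactSpace_dom (ℓ y)).clm_comp
      (ContinuousLinearMap.toSpanSingleton ℝ (indicatorConstLp 2 (hs y) (hst y) (1 : ℝ)))
  · have hP : P u = ∑ y ∈ c.range, ℓ y u • indicatorConstLp 2 (hs y) (hst y) (1 : ℝ) := by
      simp [P]
    rw [hP]
    refine (Lp.coeFn_finsetSum _ _).trans ?_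
    have hall : ∀ᵐ x, ∀ y ∈ c.range, (ℓ y u • indicatorConstLp 2 (hs y) (hst y) (1 : ℝ) :
        Lp ℝ 2 (volume : Measure (EuclideanSpace ℝ (Fin n)))) x =
        ℓ y u * (B ∩ c ⁻¹' {y}).indicator (fun _ => (1 : ℝ)) x := by
      refine (Filter.eventually_all_finset c.range).2 fun y _ => ?_
      filter_upwards [Lp.coeFn_smul (ℓ y u) (indicatorConstLp 2 (hs y) (hst y) (1 : ℝ)),
        indicatorConstLp_coeFn (p := 2) (hs := hs y) (hμs := hst y) (c := (1 : ℝ))] with x h1 h2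
      rw [h1, Pi.smul_apply, h2, smul_eq_mul]
    filter_upwards [hall] with x hx
    rw [Finset.sum_apply, Finset.sum_congr rfl hx]
    by_cases hxB : x ∈ B
    · rw [indicator_of_mem hxB, Finset.sum_eq_single (c x)]
      · simp [hxB, hℓ]
      · intro y _ hy
        simp [hxB, hy.symm]
      · intro h
        exact absurd (c.mem_range_self x) h
    · simp [hxB]

/-- The inclusion in `L^2` is compact. -/
theorem isCompactOperator_of_coeFn_eq (hp2 : 2 < p)
    (hb : MemLp (fun x => a x ^ (-(1 / p))) (ENNReal.ofReal (2 * p / (p - 2))) volume)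
    (ι : WeightedSobolev hp a ha →L[ℝ] Lp ℝ 2 (volume : Measure (EuclideanSpace ℝ (Fin n))))
    (hι : ∀ u, ι u =ᵐ[volume] u.toFun) : IsCompactOperator ι := by
  have hp0 : 0 < p := by linarith
  refine isClosed_setOfPred_isCompactOperator.closure_subset
    ((Metric.mem_closure_iff (α := WeightedSobolev hp a ha →L[ℝ]
      Lp ℝ 2 (volume : Measure (EuclideanSpace ℝ (Fin n))))).2 fun δ hδ => ?_)
  obtain ⟨B, hBm, hBb, hBδ⟩ := hb.exists_isBounded_eLpNorm_compl_le ENNReal.ofReal_ne_top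
    (by simp only [ENNReal.ofReal_pos]; positivity : 0 < ENNReal.ofReal (δ / 4))
  have hBt : volume B ≠ ⊤ := hBb.measure_lt_top.ne
  -- The factor 2^n comes from averaging over balls, the power of |B| from passing from L^p to L² on
  -- B.
  set A : ℝ≥0∞ := 2 ^ n * volume B ^ (1 / 2 - 1 / p)
  have hA : A ≠ ⊤ := ENNReal.mul_ne_top (by simp) (ENNReal.rpow_ne_top_of_nonneg (by
    rw [sub_nonneg]; exact one_div_le_one_div_of_le (by norm_num) hp2.le) hBt)
  obtain ⟨ρ, hρ, hρδ⟩ : ∃ ρ : ℝ, 0 < ρ ∧ A * ENNReal.ofReal (2 * ρ) ≤ ENNReal.ofReal (δ / 4) := by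
    -- The error is A · 2ρ = (δ/4) · A/(A + 1); adding 1 avoids dividing by A = 0.
    refine ⟨δ / 8 / (A.toReal + 1), by positivity, ?_⟩
    rw [← ENNReal.ofReal_toReal hA, ← ENNReal.ofReal_mul ENNReal.toReal_nonneg,
      ENNReal.toReal_ofReal ENNReal.toReal_nonneg]
    refine ENNReal.ofReal_le_ofReal ?_
    have h0 : 0 ≤ A.toReal := ENNReal.toReal_nonneg
    rw [← mul_assoc, ← mul_div_assoc, div_le_iff₀ (by positivity)]
    nlinarith
  obtain ⟨c, hc⟩ := exists_simpleFunc_dist_lt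
    (hBb.isCompact_closure.totallyBounded.subset subset_closure) hρ
  obtain ⟨P, hP, hPu⟩ := exists_isCompactOperator_eq_indicator_average ι hι hBm hBt c ρ
  refine ⟨P, hP, ?_⟩
  rw [dist_eq_norm]
  refine lt_of_le_of_lt ?_ (half_lt_self hδ)
  refine ContinuousLinearMap.opNorm_le_bound _ (by positivity) fun u => ?_
  have hsplit : (ι - P) u =ᵐ[volume]
      B.indicator (fun x => u.toFun x - ⨍ y in Metric.ball (c x) ρ, u.toFun y) +
        Bᶜ.indicator u.toFun := by
    rw [sub_apply]
    filter_upwards [Lp.coeFn_sub (ι u) (P u), hι u, hPu u] with x h1 h2 h3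
    rw [h1, Pi.sub_apply, h2, h3, Pi.add_apply]
    by_cases hx : x ∈ B <;> simp [hx]
  have hum := u.stronglyMeasurable_toFun
  have hdm : Measurable fun x => u.toFun x - ⨍ y in Metric.ball (c x) ρ, u.toFun y :=
    hum.measurable.sub (c.map fun z => ⨍ y in Metric.ball z ρ, u.toFun y).measurable
  have hE : eLpNorm ((ι - P) u) 2 volume ≤ ENNReal.ofReal (δ / 2) * ENNReal.ofReal ‖u‖ := by
    rw [eLpNorm_congr_ae hsplit]
    refine (eLpNorm_add_le (hdm.indicator hBm).aestronglyMeasurable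
      (hum.indicator hBm.compl).aestronglyMeasurable one_le_two).trans ?_
    rw [eLpNorm_indicator_eq_eLpNorm_restrict hBm,
      eLpNorm_indicator_eq_eLpNorm_restrict hBm.compl,
      show δ / 2 = δ / 4 + δ / 4 by ring, ENNReal.ofReal_add (by positivity) (by positivity),
      add_mul]
    refine add_le_add ?_ ((u.eLpNorm_two_restrict_le hp2 _).trans (mul_le_mul_left hBδ _))
    have h2p : (2 : ℝ≥0∞) ≤ ENNReal.ofReal p := by
      rw [← ENNReal.ofReal_ofNat 2]
      exact ENNReal.ofReal_le_ofReal hp2.le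
    refine (eLpNorm_le_eLpNorm_mul_rpow_measure_univ h2p hdm.aestronglyMeasurable).trans ?_
    rw [Measure.restrict_apply_univ, ENNReal.toReal_ofNat, ENNReal.toReal_ofReal hp0.le]
    calc _ ≤ 2 ^ n * ENNReal.ofReal (2 * ρ) * ENNReal.ofReal ‖u‖ *
          volume B ^ (1 / 2 - 1 / p) := by
          gcongr
          exact (u.isWeakGradient.eLpNorm_sub_average_ball_le hp hum hBm hρ hc).trans
            (mul_le_mul_right u.eLpNorm_grad_le _)
      _ = A * ENNReal.ofReal (2 * ρ) * ENNReal.ofReal ‖u‖ := by ring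
      _ ≤ _ := by gcongr
  rw [Lp.norm_def]
  refine (ENNReal.toReal_mono (ENNReal.mul_ne_top ENNReal.ofReal_ne_top ENNReal.ofReal_ne_top)
    hE).trans_eq ?_
  rw [ENNReal.toReal_mul, ENNReal.toReal_ofReal (by positivity),
    ENNReal.toReal_ofReal (norm_nonneg _)]

end WeightedSobolev

/-! ### The weights for small ε -/

theorem integrable_one_div_rpow_iff_memLp {n : ℕ} {p : ℝ} (hp : 2 < p)
    (a : C(EuclideanSpace ℝ (Fin n), ℝ)) (ha : ∀ x, 1 ≤ a x) :
    Integrable (fun x => 1 / a x ^ (2 / (p - 2))) ↔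
      MemLp (fun x => a x ^ (-(1 / p))) (ENNReal.ofReal (2 * p / (p - 2))) volume := by
  have hp0 : 0 < p := by linarith
  have hp2 : 0 < p - 2 := by linarith
  have hs : 0 < 2 * p / (p - 2) := by positivity
  rw [← integrable_norm_rpow_iff (continuous_rpow_of_one_le a ha _).aestronglyMeasurable
    (by simpa using hs) ENNReal.ofReal_ne_top, ENNReal.toReal_ofReal hs.le]
  refine integrable_congr (Eventually.of_forall fun x => ?_)
  have h0 : 0 ≤ a x := zero_le_one.trans (ha x)
  simp only
  rw [Real.norm_of_nonneg (Real.rpow_nonneg h0 _), ← Real.rpow_mul h0, one_div,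
    ← Real.rpow_neg h0]
  congr 1
  field_simp

/-- Two continuous functions are uniformly as close as they are in `L^∞`. -/
theorem Continuous.enorm_le_of_eLpNorm_top_le {X V : Type*} [TopologicalSpace X]
    [MeasurableSpace X] {μ : Measure X} [μ.IsOpenPosMeasure]
    [NormedAddCommGroup V] {f : X → V} (hf : Continuous f) {c : ℝ≥0∞} (h : eLpNorm f ∞ μ ≤ c)
    (x : X) : ‖f x‖ₑ ≤ c := by
  have hopen : IsOpen {x | c < ‖f x‖ₑ} := isOpen_lt continuous_const hf.enorm
  have hnull : μ {x | c < ‖f x‖ₑ} = 0 := by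
    rw [eLpNorm_exponent_top] at h
    refine measure_mono_null (fun x hx => ?_) (ae_iff.1 (ae_le_eLpNormEssSup (f := f) (μ := μ)))
    exact not_le.2 (h.trans_lt hx)
  by_contra! hx
  have : x ∈ ({x | c < ‖f x‖ₑ} : Set X) := hx
  rw [hopen.eq_empty_of_measure_zero hnull] at this
  exact this

/-- Once |a_ε - a_0| ≤ 1/2 everywhere, a_ε ≥ a_0 - 1/2 ≥ a_0 / 2, because a_0 ≥ 1. Continuity turns
the L^∞ bound into one at every point. -/
theorem exists_forall_half_le_of_tendsto {n : ℕ}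
    {a : Icc (0 : ℝ) 1 → C(EuclideanSpace ℝ (Fin n), ℝ)} (ha : ∀ x, 1 ≤ a 0 x)
    (ha_lim : Tendsto (fun ε => eLpNorm (fun x => a ε x - a 0 x) ∞ volume) (𝓝 0) (𝓝 0)) :
    ∃ ε₀ : Icc (0 : ℝ) 1, 0 < ε₀ ∧ ∀ ε ≤ ε₀, ∀ x, a 0 x / 2 ≤ a ε x := by
  have hev : ∀ᶠ ε in 𝓝 (0 : Icc (0 : ℝ) 1), ∀ x, a 0 x / 2 ≤ a ε x := by
    filter_upwards [ha_lim.eventually_le_const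
      (by simp : (0 : ℝ≥0∞) < ENNReal.ofReal (1 / 2))] with ε hε x
    have h1 := ((a ε).continuous.sub (a 0).continuous).enorm_le_of_eLpNorm_top_le hε x
    rw [← ofReal_norm, ENNReal.ofReal_le_ofReal_iff (by norm_num), Real.norm_eq_abs, abs_le] at h1
    have h2 : -(1 / 2) ≤ a ε x - a 0 x := h1.1
    linarith [ha x]
  obtain ⟨δ, hδ, hball⟩ := Metric.eventually_nhds_iff.1 hev
  refine ⟨⟨min (δ / 2) 1, by positivity, min_le_right _ _⟩, ?_, fun ε hε => hball ?_⟩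
  · rw [← Subtype.coe_lt_coe]
    simp only [Icc.coe_zero]
    positivity
  · have h1 : (ε : ℝ) ≤ δ / 2 := (Subtype.coe_le_coe.2 hε).trans (min_le_left _ _)
    rw [Subtype.dist_eq, Real.dist_eq, Icc.coe_zero, sub_zero, abs_of_nonneg ε.2.1]
    linarith

theorem eLpNorm_rpow_neg_le_of_half_le {n : ℕ} {p : ℝ} (hp : 0 < p) {q : ℝ≥0∞}
    {a b : EuclideanSpace ℝ (Fin n) → ℝ} (hb : ∀ x, 1 ≤ b x) (h : ∀ x, b x / 2 ≤ a x) :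
    eLpNorm (fun x => a x ^ (-(1 / p))) q volume ≤
      ENNReal.ofReal (2 ^ (1 / p)) * eLpNorm (fun x => b x ^ (-(1 / p))) q volume := by
  have h2 : ∀ x, ‖a x ^ (-(1 / p))‖ ≤ ‖((2 : ℝ) ^ (1 / p) • fun x => b x ^ (-(1 / p))) x‖ := by
    intro x
    have hb0 : 0 < b x := zero_lt_one.trans_le (hb x)
    have ha0 : 0 < a x := (half_pos hb0).trans_le (h x)
    rw [Real.norm_of_nonneg (by positivity), Pi.smul_apply, smul_eq_mul,
      Real.norm_of_nonneg (by positivity)]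
    refine (Real.rpow_le_rpow_of_nonpos (half_pos hb0) (h x) (by
      rw [neg_nonpos]; positivity)).trans_eq ?_
    rw [Real.div_rpow hb0.le zero_le_two, Real.rpow_neg zero_le_two, div_inv_eq_mul, mul_comm]
  refine (eLpNorm_mono h2).trans_eq ?_
  rw [eLpNorm_const_smul, Real.enorm_of_nonneg (by positivity)]

/-! ### Interpolation in E and conclusion -/

namespace WeightedSobolev

variable {n : ℕ} {p : ℝ} {hp : 1 ≤ p} {a : C(EuclideanSpace ℝ (Fin n), ℝ)} {ha : ∀ x, 1 ≤ a x}

theorem lt_sobolev_exponent (hp2 : 2 < p) (hpn : p < n) : 2 < p * n / (n - p) := by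
  have : 0 < (n : ℝ) - p := by linarith
  rw [lt_div_iff₀ this]
  nlinarith

/-- The L² norm is kept as a factor instead of being bounded by ‖u‖: one inequality then yields both
the embedding constant and the transfer of compactness. -/
theorem eLpNorm_interpolation_le (hp2 : 2 < p) (hpn : p < n) {r : ℝ} (hr : 2 ≤ r)
    (hrq : r ≤ p * n / (n - p)) (u : WeightedSobolev hp a ha) :
    eLpNorm u.toFun (ENNReal.ofReal r) volume ≤
      eLpNorm u.toFun 2 volume ^ (2 * (p * n / (n - p) - r) / ((p * n / (n - p) - 2) * r)) *
      (SNormLESNormFDerivOfEqConst ℝ (volume : Measure (EuclideanSpace ℝ (Fin n)))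
        (p.toNNReal : ℝ) * ENNReal.ofReal ‖u‖) ^
          (p * n / (n - p) * (r - 2) / ((p * n / (n - p) - 2) * r)) := by
  have hq := lt_sobolev_exponent hp2 hpn
  have h1 := eLpNorm_le_rpow_mul_rpow two_pos hr hrq hq
    u.stronglyMeasurable_toFun.aestronglyMeasurable (μ := volume)
  rw [ENNReal.ofReal_ofNat] at h1
  have h2 : 0 < (p * n / (n - p) - 2) * r := mul_pos (by linarith) (by linarith)
  exact h1.trans (mul_le_mul_right (ENNReal.rpow_le_rpow (u.eLpNorm_sobolev_le hpn)
    (div_nonneg (mul_nonneg (by linarith) (by linarith)) h2.le)) _)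

end WeightedSobolev

theorem lemma2p1 (n : ℕ) (p : ℝ) (hp : 2 < p) (hpn : p < n)
    (a : Icc (0 : ℝ) 1 → C(EuclideanSpace ℝ (Fin n), ℝ))
    (ha : ∀ ε x, 1 ≤ a ε x)
    (ha_lim : Tendsto (fun ε => eLpNorm (fun x => a ε x - a 0 x) ∞ volume) (𝓝 0) (𝓝 0))
    (ha_int : Integrable fun x => 1 / (a 0 x) ^ (2 / (p - 2))) :
    ∃ ε₀ : Icc (0 : ℝ) 1, 0 < ε₀ ∧
      (∀ ε ≤ ε₀, Integrable fun x => 1 / (a ε x) ^ (2 / (p - 2))) ∧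
      (∀ ε ≤ ε₀,
        CompleteSpace (WeightedSobolev (one_le_two.trans hp.le) (a ε) (ha ε)) ∧
        Function.Surjective (NormedSpace.inclusionInDoubleDual ℝ
          (WeightedSobolev (one_le_two.trans hp.le) (a ε) (ha ε)))) ∧
      ∀ (r : ℝ) (hr : 2 ≤ r), r ≤ p * n / (n - p) →
        haveI : Fact (1 ≤ ENNReal.ofReal r) :=
          ⟨ENNReal.one_le_ofReal.2 (one_le_two.trans hr)⟩
        ∃ C : ℝ, ∀ ε ≤ ε₀,
          ∃ ι : WeightedSobolev (one_le_two.trans hp.le) (a ε) (ha ε) →L[ℝ]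
              Lp ℝ (ENNReal.ofReal r) (volume : Measure (EuclideanSpace ℝ (Fin n))),
            (∀ u, ι u =ᵐ[volume] u.toFun) ∧
            (∀ u, ‖ι u‖ ≤ C * ‖u‖) ∧
            DenseRange ι ∧
            (r < p * n / (n - p) → IsCompactOperator ι) := by
  have hp0 : 0 < p := by linarith
  obtain ⟨ε₀, hε₀, hhalf⟩ := exists_forall_half_le_of_tendsto (ha 0) ha_lim
  have hb0 := (integrable_one_div_rpow_iff_memLp hp (a 0) (ha 0)).1 ha_int
  -- K bounds the Hölder constants of all weights with ε ≤ ε₀ at once, the factor 2^{1/p} paying for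
  -- a_ε ≥ a_0 / 2.
  set K : ℝ≥0∞ := ENNReal.ofReal (2 ^ (1 / p)) *
    eLpNorm (fun x => a 0 x ^ (-(1 / p))) (ENNReal.ofReal (2 * p / (p - 2))) volume
  have hK : K ≠ ⊤ := ENNReal.mul_ne_top ENNReal.ofReal_ne_top hb0.eLpNorm_ne_top
  have hbK : ∀ ε ≤ ε₀, eLpNorm (fun x => a ε x ^ (-(1 / p)))
      (ENNReal.ofReal (2 * p / (p - 2))) volume ≤ K := fun ε hε =>
    eLpNorm_rpow_neg_le_of_half_le hp0 (ha 0) (hhalf ε hε)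
  have hb : ∀ ε ≤ ε₀, MemLp (fun x => a ε x ^ (-(1 / p)))
      (ENNReal.ofReal (2 * p / (p - 2))) volume := fun ε hε =>
    ⟨(continuous_rpow_of_one_le (a ε) (ha ε) _).aestronglyMeasurable,
      (hbK ε hε).trans_lt hK.lt_top⟩
  refine ⟨ε₀, hε₀, fun ε hε => (integrable_one_div_rpow_iff_memLp hp (a ε) (ha ε)).2 (hb ε hε),
    fun ε _ => ?_, fun r hr hrq => ?_⟩
  · have := WeightedSobolev.uniformConvexSpace (hp := one_le_two.trans hp.le) (ha := ha ε) hp.le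
    have := WeightedSobolev.completeSpace (hp := one_le_two.trans hp.le) (ha := ha ε)
    exact ⟨this, surjective_inclusionInDoubleDual_of_uniformConvexSpace⟩
  have hfact : Fact (1 ≤ ENNReal.ofReal r) := ⟨ENNReal.one_le_ofReal.2 (one_le_two.trans hr)⟩
  have hr0 : 0 < r := by linarith
  have hq : 2 < p * n / (n - p) := WeightedSobolev.lt_sobolev_exponent hp hpn
  have hinterp := fun ε (u : WeightedSobolev (one_le_two.trans hp.le) (a ε) (ha ε)) =>
    u.eLpNorm_interpolation_le hp hpn hr hrq
  set q : ℝ := p * n / (n - p)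
  set α : ℝ := 2 * (q - r) / ((q - 2) * r)
  set β : ℝ := q * (r - 2) / ((q - 2) * r)
  have hden : 0 < (q - 2) * r := mul_pos (by linarith) hr0
  have hα : 0 ≤ α := div_nonneg (mul_nonneg (by linarith) (by linarith)) hden.le
  have hβ : 0 ≤ β := div_nonneg (mul_nonneg (by linarith) (by linarith)) hden.le
  -- This makes the product of the two bounds homogeneous of degree one in ‖u‖.
  have hαβ : α + β = 1 := by
    rw [← add_div, div_eq_one_iff_eq hden.ne']
    ring
  set CS : ℝ≥0∞ := (SNormLESNormFDerivOfEqConst ℝ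
    (volume : Measure (EuclideanSpace ℝ (Fin n))) (p.toNNReal : ℝ) : ℝ≥0∞)
  have hCS : CS ≠ ⊤ := ENNReal.coe_ne_top
  have hbound2 : ∀ ε ≤ ε₀, ∀ u : WeightedSobolev (one_le_two.trans hp.le) (a ε) (ha ε),
      eLpNorm u.toFun 2 volume ≤ K * ENNReal.ofReal ‖u‖ := fun ε hε u =>
    (u.eLpNorm_two_le hp).trans (mul_le_mul_left (hbK ε hε) _)
  have hC : K ^ α * CS ^ β ≠ ⊤ := ENNReal.mul_ne_top
    (ENNReal.rpow_ne_top_of_nonneg hα hK) (ENNReal.rpow_ne_top_of_nonneg hβ hCS)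
  have hboundr : ∀ ε ≤ ε₀, ∀ u : WeightedSobolev (one_le_two.trans hp.le) (a ε) (ha ε),
      eLpNorm u.toFun (ENNReal.ofReal r) volume ≤ K ^ α * CS ^ β * ENNReal.ofReal ‖u‖ :=
    fun ε hε u => by
      refine (hinterp ε u).trans ((mul_le_mul_left
        (ENNReal.rpow_le_rpow (hbound2 ε hε u) hα) _).trans_eq ?_)
      have h1 : ENNReal.ofReal ‖u‖ = ENNReal.ofReal ‖u‖ ^ α * ENNReal.ofReal ‖u‖ ^ β := by
        rw [← ENNReal.rpow_add_of_nonneg _ _ hα hβ, hαβ, ENNReal.rpow_one]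
      rw [ENNReal.mul_rpow_of_nonneg _ _ hα, ENNReal.mul_rpow_of_nonneg _ _ hβ]
      conv_rhs => rw [h1]
      ring
  refine ⟨(K ^ α * CS ^ β).toReal, fun ε hε =>
    ⟨WeightedSobolev.inclusionLp (ENNReal.ofReal r) _ hC (hboundr ε hε),
      WeightedSobolev.coeFn_inclusionLp, WeightedSobolev.norm_inclusionLp_le,
      WeightedSobolev.denseRange_inclusionLp ENNReal.ofReal_ne_top, fun hrlt => ?_⟩⟩
  -- The strict inequality r < p* enters only here, to keep a positive power of the L² norm.
  have hα' : 0 < α := div_pos (mul_pos two_pos (by linarith)) hden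
  refine isCompactOperator_of_norm_le_rpow_mul_rpow (C := (CS ^ β).toReal)
    (WeightedSobolev.isCompactOperator_of_coeFn_eq hp (hb ε hε)
      (WeightedSobolev.inclusionLp 2 K hK (hbound2 ε hε)) WeightedSobolev.coeFn_inclusionLp)
    ENNReal.toReal_nonneg hα' hβ fun u => ?_
  have hfin : eLpNorm u.toFun 2 volume ≠ ⊤ :=
    (WeightedSobolev.memLp_of_eLpNorm_le hK (hbound2 ε hε u)).eLpNorm_ne_top
  rw [WeightedSobolev.norm_inclusionLp, WeightedSobolev.norm_inclusionLp]
  refine (ENNReal.toReal_mono (ENNReal.mul_ne_top (ENNReal.rpow_ne_top_of_nonneg hα hfin)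
    (ENNReal.rpow_ne_top_of_nonneg hβ (ENNReal.mul_ne_top hCS ENNReal.ofReal_ne_top)))
    (hinterp ε u)).trans_eq ?_
  rw [ENNReal.toReal_mul, ENNReal.mul_rpow_of_nonneg _ _ hβ, ENNReal.toReal_mul,
    ← ENNReal.toReal_rpow (eLpNorm u.toFun 2 volume), ← ENNReal.toReal_rpow (ENNReal.ofReal ‖u‖),
    ENNReal.toReal_ofReal (norm_nonneg _)]
  ring
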